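/- Let $n\ge 2$ be an integer and $p>1$ real. For a bounded domain (nonempty open connected set) $\Omega\subset\mathbb R^n$ with Lipschitz boundary, let $|\Omega|$ be its Lebesgue measure, $\sigma$ the $(n-1)$-dimensional Hausdorff measure on $\partial\Omega$, $|\partial\Omega|=\sigma(\partial\Omega)$, $\omega_{n-1}$ the volume of the unit ball of $\mathbb R^{n-1}$, and $$I(\Omega)=\frac{|\partial\Omega|}{|\Omega|^{\frac{n-1}{n}}},\qquad D(\Omega)=\sup_{x\in\mathbb R^n,\ r>0}\frac{|\partial\Omega\cap B(x,r)|}{\omega_{n-1}r^{n-1}} .$$ For an integer $k\ge1$ let $$\sigma_{p,k}=\inf_{F\in\Gamma_k}\ \sup_{u\in F}\ \frac{\int_\Omega|\nabla u|^p\,dx}{\int_{\partial\Omega}|u|^p\,d\sigma}$$ be the $k$-th variational Steklov eigenvalue of the $p$-Laplacian, where boundary values are traces, the quotient is $+\infty$ if the trace of $u\neq0$ vanishes, and $\Gamma_k$ is the family of nonempty symmetric ($F=-F$) sets $F\subset W^{1,p}(\Omega)\setminus\{0\}$ such that $F\cap\{u:\|u\|_{L^p(\partial\Omega)}=1\}$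 is compact and the Krasnoselskii genus of $F$, i.e. the least positive integer $\ell$ for which there is a continuous odd map $F\to\mathbb R^\ell\setminus\{0\}$ ($\infty$ if there is none), is at least $k$. If $p\le n$, there is a constant $C_{p,n}>0$ depending only on $p$ and $n$ such that for every bounded domain $\Omega\subset\mathbb R^n$ with Lipschitz boundary and every integer $k\ge1$ $$|\partial\Omega|^{\frac{p-1}{n-1}}\sigma_{p,k}\le\frac{C_{p,n}}{I(\Omega)^{\frac{n-p}{n-1}}}\,k^{\frac pn}.$$ If $p>n$, there is a constant $C'_{p,n}>0$ depending only on $p$ and $n$ such that for every bounded domain $\Omega\subset\mathbb R^n$ with Lipschitz boundary one has $D(\Omega)<\infty$ and, for every integer $k\ge1$, $$|\partial\Omega|^{\frac{p-1}{n-1}}\sigma_{p,k}\le C'_{p,n}\,D(\Omega)^{\frac{p-n}{n-1}}\,k^{\frac{p-1}{n-1}}.$$ -/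

import Mathlib

open MeasureTheory Filter Topology
open scoped ENNReal NNReal ContDiff

namespace Steklov

noncomputable section

/-- `ℝⁿ` with its Euclidean structure. -/
abbrev E (n : ℕ) : Type := EuclideanSpace ℝ (Fin n)

/-! ### Domains and geometric quantities -/

/-- `Ω` has Lipschitz boundary: near each boundary point, `Ω` is, after a rotation, the open region
strictly above the graph of a Lipschitz function. Here `e` is the unit vector that points upwards
and `g` is a Lipschitz function on the hyperplane orthogonal to `e`. -/
def HasLipschitzBoundary {n : ℕ} (Ω : Set (E n)) : Prop :=
  ∀ x₀ ∈ frontier Ω, ∃ e : E n, ‖e‖ = 1 ∧ ∃ (K : ℝ≥0) (g : (ℝ ∙ e)ᗮ → ℝ), LipschitzWith K g ∧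
    ∃ U ∈ 𝓝 x₀, ∀ y ∈ U, (y ∈ Ω ↔ g ((ℝ ∙ e)ᗮ.orthogonalProjectionOnto y) < inner ℝ e y)

/-- A bounded domain (nonempty, open, connected) with Lipschitz boundary. -/
structure IsBoundedLipschitzDomain {n : ℕ} (Ω : Set (E n)) : Prop where
  isOpen : IsOpen Ω
  isConnected : IsConnected Ω
  isBounded : Bornology.IsBounded Ω
  lipschitz : HasLipschitzBoundary Ω

/-- The surface measure `dσ` on `∂Ω`: the `(n-1)`-dimensional Hausdorff measure, normalized so that
on `ℝⁿ⁻¹` it is Lebesgue measure, restricted to `∂Ω`. -/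
def surfaceMeasure {n : ℕ} (Ω : Set (E n)) : Measure (E n) :=
  (Measure.euclideanHausdorffMeasure (n - 1)).restrict (frontier Ω)

/-- `|∂Ω|`. -/
def boundaryArea {n : ℕ} (Ω : Set (E n)) : ℝ≥0∞ :=
  surfaceMeasure Ω (frontier Ω)

/-- `ω_m`, the Lebesgue measure of the unit ball of `ℝᵐ`. -/
def unitBallVolume (m : ℕ) : ℝ≥0∞ :=
  volume (Metric.ball (0 : E m) 1)

/-- The isoperimetric ratio `I(Ω) = |∂Ω| / |Ω|^((n-1)/n)`. -/
def isoperimetricRatio {n : ℕ} (Ω : Set (E n)) : ℝ≥0∞ :=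
  boundaryArea Ω / volume Ω ^ (((n : ℝ) - 1) / n)

/-- The `(n-1)`-distortion
`D(Ω) = sup_{x ∈ ℝⁿ, r > 0} |∂Ω ∩ B(x,r)| / (ω_{n-1} r^{n-1})`. -/
def distortion {n : ℕ} (Ω : Set (E n)) : ℝ≥0∞ :=
  ⨆ (x : E n) (r : ℝ) (_ : 0 < r),
    surfaceMeasure Ω (frontier Ω ∩ Metric.ball x r) /
      (unitBallVolume (n - 1) * ENNReal.ofReal r ^ (n - 1))

/-! ### The Sobolev space `W^{1,p}(Ω)` and boundary traces -/

instance factOneLeOfReal (p : ℝ) [hp : Fact (1 < p)] : Fact (1 ≤ ENNReal.ofReal p) :=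
  ⟨by simpa using hp.out.le⟩

/-- Pairs `(u, v)` with `u ∈ Lᵖ(Ω)` and `v ∈ Lᵖ(Ω; ℝⁿ)`, with the product topology. -/
abbrev LpPair {n : ℕ} (p : ℝ) (Ω : Set (E n)) : Type :=
  Lp ℝ (ENNReal.ofReal p) (volume.restrict Ω) × Lp (E n) (ENNReal.ofReal p) (volume.restrict Ω)

/-- `v` is the weak gradient of `u` in `Ω`. -/
def IsWeakGradient {n : ℕ} (Ω : Set (E n)) (u : E n → ℝ) (v : E n → E n) : Prop :=
  ∀ φ : E n → ℝ, ContDiff ℝ ∞ φ → HasCompactSupport φ → tsupport φ ⊆ Ω → ∀ e : E n,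
    ∫ x in Ω, u x * fderiv ℝ φ x e = -∫ x in Ω, inner ℝ (v x) e * φ x

/-- The Sobolev space `W^{1,p}(Ω)`. A function `u` is represented by the pair `(u, ∇u)`, where `∇u`
is its (unique) weak gradient; the subspace topology is the one given by the norm
`(∫ |∇u|ᵖ + |u|ᵖ)^{1/p}`. -/
def W1p {n : ℕ} (p : ℝ) (Ω : Set (E n)) : Set (LpPair p Ω) :=
  {w | IsWeakGradient Ω w.1 w.2}

/-- `g ∈ Lᵖ(∂Ω)` is a boundary trace of `w = (u, ∇u)`: there are `φ_j ∈ C_c^∞(ℝⁿ)` whose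
restrictions to `Ω` converge to `u` in `W^{1,p}(Ω)` and whose restrictions to `∂Ω` converge to `g`
in `Lᵖ(∂Ω)`. -/
def IsTrace {n : ℕ} {p : ℝ} {Ω : Set (E n)} (w : LpPair p Ω)
    (g : Lp ℝ (ENNReal.ofReal p) (surfaceMeasure Ω)) : Prop :=
  ∃ φ : ℕ → E n → ℝ,
    (∀ j, ContDiff ℝ ∞ (φ j) ∧ HasCompactSupport (φ j)) ∧
    Tendsto (fun j => eLpNorm (fun x => φ j x - w.1 x) (ENNReal.ofReal p) (volume.restrict Ω))
      atTop (𝓝 0) ∧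
    Tendsto (fun j => eLpNorm (fun x => gradient (φ j) x - w.2 x) (ENNReal.ofReal p)
      (volume.restrict Ω)) atTop (𝓝 0) ∧
    Tendsto (fun j => eLpNorm (fun x => φ j x - g x) (ENNReal.ofReal p) (surfaceMeasure Ω))
      atTop (𝓝 0)

open Classical in
/-- The trace operator `W^{1,p}(Ω) → Lᵖ(∂Ω)`. On a bounded Lipschitz domain every element of
`W^{1,p}(Ω)` has exactly one trace; elsewhere the value `0` is a convention. -/
def trace {n : ℕ} {p : ℝ} {Ω : Set (E n)} (w : LpPair p Ω) :
    Lp ℝ (ENNReal.ofReal p) (surfaceMeasure Ω) :=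
  if h : ∃ g, IsTrace w g then h.choose else 0

/-! ### Variational eigenvalues -/

/-- The Rayleigh quotient `∫_Ω |∇u|ᵖ / ∫_{∂Ω} |u|ᵖ`, with values in `[0,∞]`. It is `∞` if the trace
of `u` vanishes and `∇u` does not. -/
def rayleigh {n : ℕ} {p : ℝ} {Ω : Set (E n)} (w : LpPair p Ω) : ℝ≥0∞ :=
  (∫⁻ x in Ω, ‖w.2 x‖ₑ ^ p) / ∫⁻ x, ‖trace w x‖ₑ ^ p ∂(surfaceMeasure Ω)

/-- The Krasnoselskii genus of `F`: the least positive integer `ℓ` for which there is a continuous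
odd map `F → ℝ^ℓ ∖ {0}`, and `∞` if there is none. -/
def genus {X : Type*} [TopologicalSpace X] [Neg X] (F : Set X) : ℕ∞ :=
  ⨅ (ℓ : ℕ) (_ : 1 ≤ ℓ) (_ : ∃ f : X → E ℓ, ContinuousOn f F ∧
    (∀ u ∈ F, f u ≠ 0) ∧ ∀ u ∈ F, f (-u) = -f u), (ℓ : ℕ∞)

/-- The family `Γ_k` of (nonempty) symmetric sets `F ⊆ W^{1,p}(Ω) ∖ {0}` of genus at least `k` for
which `F ∩ {‖u‖_{Lᵖ(∂Ω)} = 1}` is compact. -/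
def Gam {n : ℕ} (p : ℝ) [Fact (1 < p)] (Ω : Set (E n)) (k : ℕ) : Set (Set (LpPair p Ω)) :=
  {F | F.Nonempty ∧ F ⊆ W1p p Ω \ {0} ∧ IsCompact (F ∩ {w | ‖trace w‖ = 1}) ∧
    (∀ w ∈ F, -w ∈ F) ∧ (k : ℕ∞) ≤ genus F}

/-- The variational Steklov eigenvalue `σ_{p,k} = inf_{F ∈ Γ_k} sup_{u ∈ F} R_p(u)` of the
`p`-Laplacian on `Ω`. -/
def eigenvalue {n : ℕ} (p : ℝ) [Fact (1 < p)] (Ω : Set (E n)) (k : ℕ) : ℝ≥0∞ :=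
  ⨅ F ∈ Gam p Ω k, ⨆ w ∈ F, rayleigh w

end

end Steklov

/-!
# Upper bounds for the variational Steklov eigenvalues of the `p`-Laplacian

To bound `σ_{p,k}` from above it is enough to find `k` smooth functions with disjoint supports, each
with energy at most `A` and each equal to `1` on a part of the boundary of area at least `τ`: as
`|∑ cᵢ uᵢ|ᵖ = ∑ |cᵢ|ᵖ |uᵢ|ᵖ`, all Rayleigh quotients on the unit sphere of their span are at most
`A / τ`, and by the Borsuk–Ulam theorem that sphere has genus `k` (`eigenvalue_le`). This uses that
the trace of a smooth function is its restriction to the boundary, that is, that traces are unique.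
They are, because of the local `L¹` trace inequality `IsGraphPatch.eLpNorm_le`, which comes from
integrating along segments transversal to the graph that the boundary is locally.

The test functions come from a greedy selection of balls (`exists_greedy_balls`). Put
`τ = |∂Ω| / (c k)`. Choose one ball after the other, each with the least radius, up to a factor `2`,
for which it carries area `τ` outside the eightfold enlargements of its predecessors. The
enlargement of a chosen ball is covered by boundedly many balls of half its radius, so it removes
only a bounded multiple of `τ`, and `4 k` balls can be chosen. The radii do not decrease, and twice
the ball `j` minus the fourfold enlargements of its predecessors contains the support of a cutoff
function `u j`; these supports are disjoint. A predecessor can be ignored if a later and much larger one swallows it, and after that,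
a ball has on average only boundedly many holes (`sum_card_holes_le`). Discarding the functions with
many holes, and those with `|Ω ∩ supp u j| > |Ω| / k`, leaves `k` of them.

The gradient of `u j` is then bounded by boundedly many terms `L / s` on balls of radius `2 s`. For
`p ≤ n`, such a term contributes at most
`(L / s)ᵖ min(|Ω| / k, C sⁿ) ≤ C' (|Ω| / k) ^ ((n - p) / n)` to the energy, and for `p > n` at most
`C' ρ ^ (n - p)`, where `ρ` is a lower bound for the radii. One can take for `ρ` a radius for which
`D(Ω) ω_{n-1} ρ ^ (n - 1)` is `τ / 2`, as balls of radius `ρ` then have area less than `τ`.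

The Borsuk–Ulam theorem (`borsuk_ulam`) is proved with mod 2 chains of ordered simplices. Finely
subdivided hemispheres `h j` of the cross-polytope satisfy `∂ h (j + 1) = h j + ν (h j)`, where `ν`
is the antipodal map. For functions `tᵢ` with values in `ℤ/2` that differ at antipodal points, this
forces the cup product of `j` coboundaries `δtᵢ` to be `1` on `h j` (`cup_hemisphere`). If `tᵢ` is
the sign of the `i`-th coordinate of an odd map without zeros, then on each small simplex some `δtᵢ`
vanishes; so if the map has `l` coordinates, the cup product of all `l` of them vanishes on `h l`,
and the sphere has dimension less than `l`.
-/

namespace Steklov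

/-! ### The Borsuk–Ulam theorem, by mod 2 chains of ordered simplices -/

noncomputable section

section Chains

variable {V : Type*}

/-- Augmented chains with coefficients in `ℤ/2`: formal sums of lists of vertices. The list
`[v₀, …, vₖ]` stands for an ordered, possibly degenerate, `k`-simplex, and `[]` for the simplex of
dimension `-1`. -/
abbrev Chain (V : Type*) : Type _ := List V →₀ ZMod 2

/-- The cone with apex `v` over a chain. -/
def cone (v : V) : Chain V →ₗ[ZMod 2] Chain V := Finsupp.lmapDomain _ _ (List.cons v)

@[simp] lemma cone_single (v : V) (l : List V) (a : ZMod 2) :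
    cone v (Finsupp.single l a) = Finsupp.single (v :: l) a := by
  simp [cone]

/-- The boundary of a single simplex. -/
def simplexBoundary : List V → Chain V
  | [] => 0
  | v :: l => Finsupp.single l 1 + cone v (simplexBoundary l)

/-- The boundary operator. -/
def boundary : Chain V →ₗ[ZMod 2] Chain V := Finsupp.linearCombination _ simplexBoundary

@[simp] lemma boundary_single (l : List V) (a : ZMod 2) :
    boundary (Finsupp.single l a) = a • simplexBoundary l := by
  simp [boundary]

lemma add_self_chain (c : Chain V) : c + c = 0 := by
  ext l
  exact CharTwo.add_self_eq_zero _

lemma boundary_cone (v : V) (c : Chain V) : boundary (cone v c) = c + cone v (boundary c) := by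
  induction c using Finsupp.induction_linear with
  | zero => simp
  | add f g hf hg => simp only [map_add, hf, hg]; abel
  | single l a => simp [simplexBoundary, smul_add]

lemma boundary_simplexBoundary (l : List V) : boundary (simplexBoundary l) = 0 := by
  induction l with
  | nil => simp [simplexBoundary]
  | cons v l ih => simp [simplexBoundary, boundary_cone, ih, add_self_chain]

/-- The map of chains induced by a map of vertices. -/
def mapChain {U : Type*} (f : V → U) : Chain V →ₗ[ZMod 2] Chain U :=
  Finsupp.lmapDomain _ _ (List.map f)

@[simp] lemma mapChain_single {U : Type*} (f : V → U) (l : List V) (a : ZMod 2) :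
    mapChain f (Finsupp.single l a) = Finsupp.single (l.map f) a := by
  simp [mapChain]

lemma mapChain_cone {U : Type*} (f : V → U) (v : V) (c : Chain V) :
    mapChain f (cone v c) = cone (f v) (mapChain f c) := by
  induction c using Finsupp.induction_linear with
  | zero => simp
  | add f g hf hg => simp only [map_add, hf, hg]
  | single l a => simp

lemma mapChain_simplexBoundary {U : Type*} (f : V → U) (l : List V) :
    mapChain f (simplexBoundary l) = simplexBoundary (l.map f) := by
  induction l with
  | nil => simp [simplexBoundary]
  | cons v l ih => simp [simplexBoundary, mapChain_cone, ih]

/-- The submodule of the chains all of whose simplices satisfy `P`. -/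
abbrev chainsOf (P : List V → Prop) : Submodule (ZMod 2) (Chain V) :=
  Finsupp.supported (ZMod 2) (ZMod 2) {l | P l}

lemma map_mem_chainsOf {U : Type*} {P : List V → Prop} {Q : List U → Prop}
    (T : Chain V →ₗ[ZMod 2] Chain U)
    (h : ∀ l, P l → T (Finsupp.single l 1) ∈ chainsOf Q) {c : Chain V} (hc : c ∈ chainsOf P) :
    T c ∈ chainsOf Q := by
  rw [chainsOf, Finsupp.supported_eq_span_single] at hc
  induction hc using Submodule.span_induction with
  | mem x hx => obtain ⟨l, hl, rfl⟩ := hx; exact h l hl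
  | zero => simp
  | add x y _ _ hx hy => rw [map_add]; exact Submodule.add_mem _ hx hy
  | smul a x _ hx => rw [map_smul]; exact Submodule.smul_mem _ _ hx

lemma cone_mem_chainsOf {P Q : List V → Prop} (v : V) (h : ∀ l, P l → Q (v :: l)) {c : Chain V}
    (hc : c ∈ chainsOf P) : cone v c ∈ chainsOf Q :=
  map_mem_chainsOf _ (fun l hl => by
    rw [cone_single]; exact Finsupp.single_mem_supported _ _ (h l hl)) hc

lemma chainsOf_mono {P Q : List V → Prop} (h : ∀ l, P l → Q l) {c : Chain V}
    (hc : c ∈ chainsOf P) : c ∈ chainsOf Q :=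
  Finsupp.supported_mono (fun l hl => h l hl) hc

lemma simplexBoundary_mem (l : List V) :
    simplexBoundary l ∈ chainsOf fun l' => l'.length + 1 = l.length ∧ l' ⊆ l := by
  induction l with
  | nil => simp [simplexBoundary]
  | cons v l ih =>
    refine Submodule.add_mem _ (Finsupp.single_mem_supported _ _ ⟨by simp, by simp⟩) ?_
    refine cone_mem_chainsOf v (fun l' hl' => ?_) ih
    exact ⟨by simp [← hl'.1], List.cons_subset_cons _ hl'.2⟩

lemma functional_eq_on {P : List V → Prop} (S T : Chain V →ₗ[ZMod 2] ZMod 2)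
    (h : ∀ l, P l → S (Finsupp.single l 1) = T (Finsupp.single l 1)) {c : Chain V}
    (hc : c ∈ chainsOf P) : S c = T c := by
  rw [chainsOf, Finsupp.supported_eq_span_single] at hc
  induction hc using Submodule.span_induction with
  | mem x hx => obtain ⟨l, hl, rfl⟩ := hx; exact h l hl
  | zero => simp
  | add x y _ _ hx hy => rw [map_add, map_add, hx, hy]
  | smul a x _ hx => rw [map_smul, map_smul, hx]

/-! ### Cup products of coboundaries of sign functions -/

/-- For functions `t i : V → ℤ/2`, the value of the cup product `δtᵢ ∪ δtᵢ₊₁ ∪ ⋯` on a simplex. -/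
def cupSimplex (t : ℕ → V → ZMod 2) : ℕ → List V → ZMod 2
  | _, [] => 0
  | _, [_] => 1
  | i, v :: w :: l => (t i v + t i w) * cupSimplex t (i + 1) (w :: l)

/-- The value of the cup product `tᵢ ∪ δtᵢ₊₁ ∪ ⋯` on a simplex. -/
def primitiveSimplex (t : ℕ → V → ZMod 2) (i : ℕ) : List V → ZMod 2
  | [] => 0
  | v :: l => t i v * cupSimplex t (i + 1) (v :: l)

/-- The cochain `δtᵢ ∪ δtᵢ₊₁ ∪ ⋯`. -/
def cup (t : ℕ → V → ZMod 2) (i : ℕ) : Chain V →ₗ[ZMod 2] ZMod 2 :=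
  Finsupp.linearCombination _ (cupSimplex t i)

/-- The cochain `tᵢ ∪ δtᵢ₊₁ ∪ ⋯`, whose coboundary is `δtᵢ ∪ δtᵢ₊₁ ∪ ⋯`. -/
def primitive (t : ℕ → V → ZMod 2) (i : ℕ) : Chain V →ₗ[ZMod 2] ZMod 2 :=
  Finsupp.linearCombination _ (primitiveSimplex t i)

@[simp] lemma cup_single (t : ℕ → V → ZMod 2) (i : ℕ) (l : List V) (a : ZMod 2) :
    cup t i (Finsupp.single l a) = a * cupSimplex t i l := by
  simp [cup]

@[simp] lemma primitive_single (t : ℕ → V → ZMod 2) (i : ℕ) (l : List V) (a : ZMod 2) :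
    primitive t i (Finsupp.single l a) = a * primitiveSimplex t i l := by
  simp [primitive]

lemma cup_cone_cone (t : ℕ → V → ZMod 2) (i : ℕ) (v w : V) (c : Chain V) :
    cup t i (cone v (cone w c)) = (t i v + t i w) * cup t (i + 1) (cone w c) := by
  induction c using Finsupp.induction_linear with
  | zero => simp
  | add f g hf hg => simp only [map_add, hf, hg]; ring
  | single l a => simp [cupSimplex]; ring

lemma primitive_cone (t : ℕ → V → ZMod 2) (i : ℕ) (v : V) (c : Chain V) :
    primitive t i (cone v c) = t i v * cup t (i + 1) (cone v c) := by
  induction c using Finsupp.induction_linear with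
  | zero => simp
  | add f g hf hg => simp only [map_add, hf, hg]; ring
  | single l a => simp [primitiveSimplex]; ring

lemma cup_boundary (t : ℕ → V → ZMod 2) (i : ℕ) (l : List V) :
    cup t i (simplexBoundary l) = 0 := by
  have two : (1 : ZMod 2) + 1 = 0 := by decide
  induction l generalizing i with
  | nil => simp [simplexBoundary]
  | cons v l ih =>
    cases l with
    | nil => simp [simplexBoundary, cupSimplex]
    | cons w l =>
      have h := ih (i + 1)
      simp only [simplexBoundary, map_add, cone_single, cup_single, one_mul] at h ⊢
      have h1 : cup t (i + 1) (cone w (simplexBoundary l)) = cupSimplex t (i + 1) l := by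
        rw [← CharTwo.add_eq_zero, add_comm, h]
      rw [cup_cone_cone, h1]
      cases l with
      | nil => simp [cupSimplex, two]
      | cons x l =>
        simp only [cupSimplex]
        linear_combination (t i v + t i w + t i x) * cupSimplex t (i + 1) (x :: l) * two

lemma primitive_boundary (t : ℕ → V → ZMod 2) (i : ℕ) (v w : V) (l : List V) :
    primitive t i (simplexBoundary (v :: w :: l)) = cupSimplex t i (v :: w :: l) := by
  have two : (1 : ZMod 2) + 1 = 0 := by decide
  have h := cup_boundary t (i + 1) (v :: w :: l)
  simp only [simplexBoundary, map_add, cone_single, cup_single, one_mul, primitive_single,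
    primitive_cone, primitiveSimplex, cupSimplex] at h ⊢
  linear_combination (t i v) * h - t i v * cupSimplex t (i + 1) (w :: l) * two

section Odd

variable [Neg V] {t : ℕ → V → ZMod 2} {P : V → Prop}

lemma cupSimplex_neg (ht : ∀ i v, P v → t i (-v) = t i v + 1) (i : ℕ) (l : List V)
    (hl : ∀ v ∈ l, P v) : cupSimplex t i (l.map Neg.neg) = cupSimplex t i l := by
  have two : (1 : ZMod 2) + 1 = 0 := by decide
  induction l generalizing i with
  | nil => rfl
  | cons v l ih =>
    cases l with
    | nil => rfl
    | cons w l =>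
      have := ih (i + 1) (fun v hv => hl v (by simp [hv]))
      simp only [List.map_cons, cupSimplex] at this ⊢
      rw [this, ht i v (hl _ (by simp)), ht i w (hl _ (by simp))]
      linear_combination cupSimplex t (i + 1) (w :: l) * two

lemma primitiveSimplex_neg (ht : ∀ i v, P v → t i (-v) = t i v + 1) (i : ℕ) (l : List V)
    (hl : ∀ v ∈ l, P v) : primitiveSimplex t i (l.map Neg.neg) =
      primitiveSimplex t i l + cupSimplex t (i + 1) l := by
  cases l with
  | nil => simp [primitiveSimplex, cupSimplex]
  | cons v l =>
    have := cupSimplex_neg ht (i + 1) (v :: l) hl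
    simp only [List.map_cons, primitiveSimplex] at this ⊢
    rw [this, ht i v (hl _ (by simp))]
    ring

/-- Let `h 0, h 1, …` be chains, of dimensions `0, 1, …`, such that the boundary of `h (j + 1)` is
`h j` plus its antipode, as for the closed hemispheres of a sphere. On `h j`, any product of `j`
coboundaries of odd functions takes the same value as `1` does on `h 0`. -/
lemma cup_hemisphere (ht : ∀ i v, P v → t i (-v) = t i v + 1) (h : ℕ → Chain V) (m : ℕ)
    (hP : ∀ j ≤ m, h j ∈ chainsOf fun l => l.length = j + 1 ∧ ∀ v ∈ l, P v)
    (hb : ∀ j < m, boundary (h (j + 1)) = h j + mapChain Neg.neg (h j))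
    (h0 : ∀ i, cup t i (h 0) = 1) : ∀ j ≤ m, ∀ i, cup t i (h j) = 1 := by
  intro j
  induction j with
  | zero => exact fun _ => h0
  | succ j ih =>
    intro hj i
    have e1 : cup t i (h (j + 1)) = primitive t i (boundary (h (j + 1))) := by
      refine functional_eq_on _ (primitive t i ∘ₗ boundary) (fun l hl => ?_) (hP _ hj)
      match l, hl with
      | v :: w :: l, _ => simp [primitive_boundary]
    have e2 : primitive t i (mapChain Neg.neg (h j)) =
        primitive t i (h j) + cup t (i + 1) (h j) := by
      refine functional_eq_on (primitive t i ∘ₗ mapChain Neg.neg) (primitive t i + cup t (i + 1))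
        (fun l hl => ?_) (hP j (by omega))
      simp [primitiveSimplex_neg ht i l hl.2]
    rw [e1, hb j (by omega), map_add, e2, ih (by omega), ← add_assoc, CharTwo.add_self_eq_zero,
      zero_add]

end Odd

end Chains

section CrossPolytope

variable {V : Type*} [AddGroup V]

/-- The boundary of the cross-polytope with vertices `± e 0, …, ± e (j - 1)`, as a chain. It is the
union of the hemispheres `cone (± e (j - 1)) (crossPolytope e (j - 1))`. -/
def crossPolytope (e : ℕ → V) : ℕ → Chain V
  | 0 => Finsupp.single [] 1
  | j + 1 => cone (e j) (crossPolytope e j) + cone (-e j) (crossPolytope e j)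

lemma boundary_crossPolytope (e : ℕ → V) (j : ℕ) : boundary (crossPolytope e j) = 0 := by
  induction j with
  | zero => simp [crossPolytope, simplexBoundary]
  | succ j ih => simp [crossPolytope, boundary_cone, ih, add_self_chain]

lemma crossPolytope_neg (e : ℕ → V) (j : ℕ) :
    mapChain Neg.neg (crossPolytope e j) = crossPolytope e j := by
  induction j with
  | zero => simp [crossPolytope]
  | succ j ih =>
    simp only [crossPolytope, map_add, mapChain_cone, ih, neg_neg]
    exact add_comm _ _

/-- The boundary of a hemisphere consists of the two hemispheres of one dimension less. -/
lemma boundary_cone_crossPolytope (e : ℕ → V) (j : ℕ) :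
    boundary (cone (e (j + 1)) (crossPolytope e (j + 1))) =
      cone (e j) (crossPolytope e j) + mapChain Neg.neg (cone (e j) (crossPolytope e j)) := by
  rw [boundary_cone, boundary_crossPolytope, map_zero, add_zero, mapChain_cone, crossPolytope_neg]
  rfl

end CrossPolytope

section Subdivision

variable {V : Type*} [NormedAddCommGroup V] [NormedSpace ℝ V]

/-- The barycenter of a simplex. -/
def barycenter (l : List V) : V := (l.length : ℝ)⁻¹ • l.sum

/-- Barycentric subdivision of chains of simplices with `m` vertices: the cone from the barycenter
over the subdivided boundary. It commutes with the boundary also on simplices with another number of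
vertices, where it has no geometric meaning. -/
def subdivide : ℕ → Chain V →ₗ[ZMod 2] Chain V
  | 0 => LinearMap.id
  | m + 1 => Finsupp.linearCombination _ fun l =>
      cone (barycenter l) (subdivide m (simplexBoundary l))

lemma subdivide_succ_single (m : ℕ) (l : List V) :
    subdivide (m + 1) (Finsupp.single l 1) =
      cone (barycenter l) (subdivide m (simplexBoundary l)) := by
  simp [subdivide]

/-- Subdivision is a chain map. -/
lemma boundary_subdivide (m : ℕ) (c : Chain V) :
    boundary (subdivide (m + 1) c) = subdivide m (boundary c) := by
  suffices h : ∀ l : List V, boundary (subdivide (m + 1) (Finsupp.single l 1)) =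
      subdivide m (boundary (Finsupp.single l 1)) by
    have : boundary ∘ₗ subdivide (m + 1) = subdivide m ∘ₗ (boundary (V := V)) := by
      ext1 l
      ext1
      exact h l
    exact LinearMap.congr_fun this c
  induction m with
  | zero =>
    intro l
    simp [boundary_cone, subdivide, boundary_simplexBoundary]
  | succ m ih =>
    intro l
    have h : boundary ∘ₗ subdivide (m + 1) = subdivide m ∘ₗ (boundary (V := V)) := by
      ext1 l
      ext1
      exact ih l
    have h' := LinearMap.congr_fun h (simplexBoundary l)
    simp only [LinearMap.comp_apply, boundary_simplexBoundary, map_zero] at h'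
    rw [subdivide_succ_single, boundary_cone, h']
    simp

lemma barycenter_neg (l : List V) : barycenter (l.map Neg.neg) = -barycenter l := by
  have : (l.map Neg.neg).sum = -l.sum := by
    induction l with
    | nil => simp
    | cons v l ih => simp only [List.map_cons, List.sum_cons, ih]; abel
  rw [barycenter, this, List.length_map, smul_neg, barycenter]

lemma subdivide_neg (m : ℕ) (c : Chain V) :
    mapChain Neg.neg (subdivide m c) = subdivide m (mapChain Neg.neg c) := by
  induction m generalizing c with
  | zero => rfl
  | succ m ih =>
    have : mapChain Neg.neg ∘ₗ subdivide (m + 1) =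
        subdivide (m + 1) ∘ₗ mapChain (Neg.neg : V → V) := by
      ext1 l
      ext1
      simp only [LinearMap.comp_apply, Finsupp.lsingle_apply, mapChain_single,
        subdivide_succ_single, mapChain_cone, ih, mapChain_simplexBoundary, barycenter_neg]
    exact LinearMap.congr_fun this c

lemma sum_map_le_of_zero {V : Type*} {f : V → ℝ} {d : ℝ} {l : List V} (hd : ∀ w ∈ l, f w ≤ d)
    {v : V} (hv : v ∈ l) (h0 : f v = 0) : (l.map f).sum ≤ (l.length - 1) * d := by
  induction l with
  | nil => simp at hv
  | cons w l ih =>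
    rcases List.mem_cons.1 hv with rfl | hv
    · have := List.sum_le_card_nsmul (l.map f) d (by
        intro x hx
        obtain ⟨w, hw, rfl⟩ := List.mem_map.1 hx
        exact hd w (by simp [hw]))
      simp only [List.map_cons, List.sum_cons, h0, List.length_cons, Nat.cast_add, Nat.cast_one]
      simpa using this
    · have h1 := ih (fun w hw => hd w (by simp [hw])) hv
      have h2 := hd w (by simp)
      simp only [List.map_cons, List.sum_cons, List.length_cons, Nat.cast_add, Nat.cast_one]
      linarith

lemma dist_barycenter_le {l : List V} {d : ℝ} (hd : ∀ v ∈ l, ∀ w ∈ l, dist v w ≤ d) {v : V}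
    (hv : v ∈ l) : dist v (barycenter l) ≤ (1 - (l.length : ℝ)⁻¹) * d := by
  have hl : 0 < (l.length : ℝ) := by
    exact_mod_cast List.length_pos_of_mem hv
  have e : barycenter l - v = (l.length : ℝ)⁻¹ • (l.map fun w => w - v).sum := by
    have : (l.map fun w => w - v).sum = l.sum - (l.length : ℝ) • v := by
      clear hd hv hl
      induction l with
      | nil => simp
      | cons w l ih =>
        simp only [List.map_cons, List.sum_cons, ih, List.length_cons, Nat.cast_add, Nat.cast_one,
          add_smul, one_smul]
        abel
    rw [this, smul_sub, inv_smul_smul₀ hl.ne', barycenter]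
  have h1 : ‖(l.map fun w => w - v).sum‖ ≤ (l.map fun w => ‖w - v‖).sum := by
    clear hd hv e hl
    induction l with
    | nil => simp
    | cons w l ih =>
      simp only [List.map_cons, List.sum_cons]
      exact (norm_add_le _ _).trans (by gcongr)
  have h2 := sum_map_le_of_zero (f := fun w => ‖w - v‖) (d := d)
    (fun w hw => by rw [← dist_eq_norm]; exact hd w hw v hv) hv (by simp)
  rw [dist_comm, dist_eq_norm, e, norm_smul, Real.norm_of_nonneg (by positivity)]
  calc _ ≤ (l.length : ℝ)⁻¹ * ((l.length - 1) * d) := by gcongr; exact h1.trans h2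
    _ = _ := by field_simp

/-- Subdivision keeps simplices inside convex sets and shrinks them by a fixed factor. -/
lemma subdivide_mem {M : ℕ} {m : ℕ} (hm : m ≤ M) {K : Set V} (hK : Convex ℝ K) {d : ℝ}
    (hd0 : 0 ≤ d) {l : List V} (hl : l.length = m) (hlK : ∀ v ∈ l, v ∈ K)
    (hd : ∀ v ∈ l, ∀ w ∈ l, dist v w ≤ d) :
    subdivide m (Finsupp.single l 1) ∈ chainsOf fun l' => l'.length = m ∧ (∀ v ∈ l', v ∈ K) ∧
      ∀ v ∈ l', ∀ w ∈ l', dist v w ≤ (1 - (M : ℝ)⁻¹) * d := by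
  induction m generalizing K l with
  | zero =>
    obtain rfl := List.length_eq_zero_iff.1 hl
    exact Finsupp.single_mem_supported _ _ (by simp)
  | succ m ih =>
    have hq : (1 - (l.length : ℝ)⁻¹) * d ≤ (1 - (M : ℝ)⁻¹) * d := by
      rw [hl]
      gcongr
    have hq0 : 0 ≤ (1 - (M : ℝ)⁻¹) * d := by
      have : (M : ℝ)⁻¹ ≤ 1 := inv_le_one_of_one_le₀ (by exact_mod_cast (by omega : 1 ≤ M))
      have := sub_nonneg.2 this
      positivity
    have hne : l ≠ [] := by rintro rfl; simp at hl
    have hhull : convexHull ℝ {v | v ∈ l} ⊆ K := convexHull_min hlK hK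
    have hball : convexHull ℝ {v | v ∈ l} ⊆
        Metric.closedBall (barycenter l) ((1 - (M : ℝ)⁻¹) * d) :=
      convexHull_min (fun v hv => (dist_barycenter_le hd hv).trans hq) (convex_closedBall _ _)
    have hb : barycenter l ∈ convexHull ℝ {v | v ∈ l} := by
      have := (convex_convexHull ℝ {v | v ∈ l}).sum_mem (t := Finset.univ)
        (w := fun _ : Fin l.length => (l.length : ℝ)⁻¹) (z := fun i => l.get i)
        (fun _ _ => by positivity) (by simp [hl]; field_simp)
        (fun i _ => subset_convexHull ℝ _ (l.get_mem i))
      rw [← Finset.smul_sum] at this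
      rwa [← List.sum_ofFn, List.ofFn_get] at this
    rw [subdivide_succ_single]
    have key : subdivide m (simplexBoundary l) ∈ chainsOf fun l' => l'.length = m ∧
        (∀ v ∈ l', v ∈ convexHull ℝ {v | v ∈ l}) ∧
        ∀ v ∈ l', ∀ w ∈ l', dist v w ≤ (1 - (M : ℝ)⁻¹) * d := by
      refine map_mem_chainsOf _ (fun l' hl' => ?_) (simplexBoundary_mem l)
      exact ih (by omega) (convex_convexHull ℝ _) (by omega)
        (fun v hv => subset_convexHull ℝ _ (hl'.2 hv))
        (fun v hv w hw => hd v (hl'.2 hv) w (hl'.2 hw))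
    refine cone_mem_chainsOf _ (fun l' ⟨h1, h2, h3⟩ => ⟨by simp [h1], ?_, ?_⟩) key
    · intro v hv
      rcases List.mem_cons.1 hv with rfl | hv
      · exact hhull hb
      · exact hhull (h2 v hv)
    · intro v hv w hw
      rcases List.mem_cons.1 hv with rfl | hv <;> rcases List.mem_cons.1 hw with rfl | hw
      · simpa using hq0
      · rw [dist_comm]; exact hball (h2 w hw)
      · exact hball (h2 v hv)
      · exact h3 v hv w hw

/-- Iterated subdivision makes the simplices of a chain arbitrarily small. -/
lemma subdivide_pow_mem {M m : ℕ} (hm : m ≤ M) (𝓚 : Set (Set V)) (hK : ∀ K ∈ 𝓚, Convex ℝ K)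
    {d : ℝ} (hd0 : 0 ≤ d) {c : Chain V}
    (hc : c ∈ chainsOf fun l => l.length = m ∧ (∃ K ∈ 𝓚, ∀ v ∈ l, v ∈ K) ∧
      ∀ v ∈ l, ∀ w ∈ l, dist v w ≤ d) (r : ℕ) :
    (subdivide m)^[r] c ∈ chainsOf fun l => l.length = m ∧ (∃ K ∈ 𝓚, ∀ v ∈ l, v ∈ K) ∧
      ∀ v ∈ l, ∀ w ∈ l, dist v w ≤ (1 - (M : ℝ)⁻¹) ^ r * d := by
  induction r with
  | zero => simpa using hc
  | succ r ih =>
    rw [Function.iterate_succ_apply']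
    refine map_mem_chainsOf _ (fun l ⟨h1, ⟨K, hK1, hK2⟩, h3⟩ => ?_) ih
    have hq : 0 ≤ (1 - (M : ℝ)⁻¹) := sub_nonneg.2 (Nat.cast_inv_le_one M)
    have := subdivide_mem hm (hK K hK1) (by positivity) h1 hK2 h3
    refine chainsOf_mono (fun l' ⟨h1, h2, h3⟩ => ⟨h1, ⟨K, hK1, h2⟩, ?_⟩) this
    rw [pow_succ']
    simpa only [mul_assoc] using h3

end Subdivision

/-- The cup product vanishes on a simplex on which one of its factors `δt` vanishes. -/
lemma cupSimplex_eq_zero {V : Type*} (t : ℕ → V → ZMod 2) (i a : ℕ) (l : List V)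
    (hi : i + 1 < l.length) (hc : ∀ v ∈ l, ∀ w ∈ l, t (a + i) v = t (a + i) w) :
    cupSimplex t a l = 0 := by
  induction l generalizing i a with
  | nil => rfl
  | cons v l ih =>
    cases l with
    | nil => simp at hi
    | cons w l =>
      rw [cupSimplex]
      cases i with
      | zero =>
        have := hc v (by simp) w (by simp)
        simp only [add_zero] at this
        rw [this, CharTwo.add_self_eq_zero, zero_mul]
      | succ i =>
        rw [ih i (a + 1) (by simpa using hi) (fun v hv w hw => ?_), mul_zero]
        have := hc v (by simp [hv]) w (by simp [hw])
        rwa [show a + 1 + i = a + (i + 1) by ring]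

/-- A vector space carries a function to `ℤ/2` that separates each nonzero vector from its
opposite. -/
lemma exists_odd_sign (V : Type*) [AddCommGroup V] [Module ℝ V] :
    ∃ s : V → ZMod 2, ∀ v, v ≠ 0 → s (-v) = s v + 1 := by
  classical
  refine ⟨fun v => if WellOrderingRel v (-v) then 1 else 0, fun v hv => ?_⟩
  have hne : v ≠ -v := fun h => hv (by
    have h2 := add_eq_zero_iff_eq_neg.2 h
    rw [← two_smul ℝ, smul_eq_zero] at h2
    exact h2.resolve_left two_ne_zero)
  have two : (1 : ZMod 2) + 1 = 0 := by decide
  simp only [neg_neg]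
  rcases trichotomous_of WellOrderingRel v (-v) with h | h | h
  · rw [if_neg (asymm_of WellOrderingRel h), if_pos h, two]
  · exact absurd h hne
  · rw [if_pos h, if_neg (asymm_of WellOrderingRel h), zero_add]

/-- The simplices of the cross-polytope lie in affine hyperplanes that avoid the origin. -/
lemma crossPolytope_mem (k : ℕ) (e : ℕ → E k)
    (he : ∀ j (hj : j < k), e j = EuclideanSpace.single ⟨j, hj⟩ (1 : ℝ)) (j : ℕ) (hj : j ≤ k) :
    crossPolytope e j ∈ chainsOf fun l => l.length = j ∧ ∃ ε : Fin k → ℝ, (∀ i, |ε i| = 1) ∧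
      ∀ v ∈ l, ‖v‖ ≤ 1 ∧ ∑ i, ε i * v i = 1 ∧ ∀ i : Fin k, j ≤ i → v i = 0 := by
  induction j with
  | zero => exact Finsupp.single_mem_supported _ _ (by simpa using ⟨fun _ => 1, by simp⟩)
  | succ j ih =>
    have ih := ih (by omega)
    have main : ∀ s : ℝ, |s| = 1 → ∀ w : E k, w = s • e j → cone w (crossPolytope e j) ∈
        chainsOf fun l => l.length = j + 1 ∧ ∃ ε : Fin k → ℝ, (∀ i, |ε i| = 1) ∧
      ∀ v ∈ l, ‖v‖ ≤ 1 ∧ ∑ i, ε i * v i = 1 ∧ ∀ i : Fin k, j + 1 ≤ i → v i = 0 := by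
      intro s hs w hw
      have hs2 : s * s = 1 := by rw [← abs_mul_abs_self, hs, one_mul]
      refine cone_mem_chainsOf _ (fun l ⟨hl, ε, hε, h⟩ => ⟨by simp [hl],
        Function.update ε ⟨j, hj⟩ s, fun i => ?_, fun v hv => ?_⟩) ih
      · by_cases hi : i = ⟨j, hj⟩
        · subst hi; simpa using hs
        · simpa [hi] using hε i
      · rcases List.mem_cons.1 hv with rfl | hv
        · rw [hw, he j hj]
          refine ⟨by simp [norm_smul, hs], ?_, fun i hi => ?_⟩
          · rw [Finset.sum_eq_single ⟨j, hj⟩]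
            · simp [hs2]
            · intro i _ hi; simp [hi]
            · simp
          · have : i ≠ ⟨j, hj⟩ := by rintro rfl; simp at hi
            simp [this]
        · obtain ⟨h1, h2, h3⟩ := h v hv
          refine ⟨h1, ?_, fun i hi => h3 i (by omega)⟩
          rw [← h2]
          refine Finset.sum_congr rfl fun i _ => ?_
          by_cases hi : i = ⟨j, hj⟩
          · subst hi; simp [h3 ⟨j, hj⟩ le_rfl]
          · simp [hi]
    exact Submodule.add_mem _ (main 1 (by simp) _ (by simp)) (main (-1) (by simp) _ (by simp))

/-- The Borsuk–Ulam theorem: an odd continuous map from the unit sphere of `ℝᵏ` to `ℝˡ` that has no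
zero exists only if `k ≤ l`. -/
theorem borsuk_ulam {k l : ℕ} (f : E k → Fin l → ℝ)
    (hf : ContinuousOn f (Metric.sphere 0 1)) (h0 : ∀ x ∈ Metric.sphere (0 : E k) 1, f x ≠ 0)
    (hodd : ∀ x ∈ Metric.sphere (0 : E k) 1, f (-x) = -f x) : k ≤ l := by
  classical
  by_contra! hlk
  have hk : 0 < k := by omega
  have : Nonempty (Fin k) := ⟨⟨0, hk⟩⟩
  have hcpt : IsCompact (Metric.sphere (0 : E k) 1) := isCompact_sphere _ _
  -- a uniform lower bound for `f`, and a scale on which `f` varies by less than it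
  obtain ⟨c, hc, hcf⟩ : ∃ c > 0, ∀ x ∈ Metric.sphere (0 : E k) 1, c ≤ ‖f x‖ := by
    have hne : (Metric.sphere (0 : E k) 1).Nonempty :=
      ⟨EuclideanSpace.single ⟨0, hk⟩ 1, by simp⟩
    obtain ⟨x, hx, hmin⟩ := hcpt.exists_isMinOn hne hf.norm
    exact ⟨‖f x‖, norm_pos_iff.2 (h0 x hx), fun y hy => hmin hy⟩
  obtain ⟨δ, hδ, hδf⟩ := Metric.uniformContinuousOn_iff.1
    (hcpt.uniformContinuousOn_of_continuous hf) c hc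
  -- the projection to the sphere, and its modulus of continuity away from the origin
  have hnorm : ∀ v : E k, v ≠ 0 → ‖v‖⁻¹ • v ∈ Metric.sphere (0 : E k) 1 := fun v hv => by
    simp [norm_smul, hv]
  have hproj : ∀ v w : E k, 1 ≤ k * ‖v‖ → w ≠ 0 →
      dist (‖v‖⁻¹ • v) (‖w‖⁻¹ • w) ≤ 2 * k * dist v w := by
    intro v w hv hw
    have hv0 : 0 < ‖v‖ := by
      by_contra h
      have : ‖v‖ = 0 := le_antisymm (not_lt.1 h) (norm_nonneg _)
      rw [this] at hv
      norm_num at hv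
    have hw0 : 0 < ‖w‖ := norm_pos_iff.2 hw
    have e : ‖v‖⁻¹ • v - ‖w‖⁻¹ • w = ‖v‖⁻¹ • ((v - w) + (‖w‖ - ‖v‖) • (‖w‖⁻¹ • w)) := by
      match_scalars <;> field_simp
      ring
    have h1 : ‖(‖w‖ - ‖v‖) • (‖w‖⁻¹ • w)‖ ≤ ‖v - w‖ := by
      rw [norm_smul, norm_smul, norm_inv, norm_norm, inv_mul_cancel₀ hw0.ne', mul_one,
        norm_sub_rev v w]
      exact abs_norm_sub_norm_le w v
    have h2 : ‖v‖⁻¹ ≤ k := by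
      rw [inv_le_iff_one_le_mul₀ hv0]; exact hv
    rw [dist_eq_norm, dist_eq_norm, e, norm_smul, norm_inv, norm_norm]
    calc _ ≤ (k : ℝ) * (‖v - w‖ + ‖v - w‖) := by
          gcongr
          exact (norm_add_le _ _).trans (by gcongr)
      _ = _ := by ring
  obtain ⟨s, hs⟩ := exists_odd_sign (E k)
  let G : ℕ → E k → ℝ := fun i v => if h : i < l then f (‖v‖⁻¹ • v) ⟨i, h⟩ else 0
  have hG : ∀ i v, v ≠ 0 → G i (-v) = -G i v := by
    intro i v hv
    simp only [G, norm_neg, smul_neg]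
    split_ifs with h
    · rw [hodd _ (hnorm v hv), Pi.neg_apply]
    · simp
  let t : ℕ → E k → ZMod 2 := fun i v => if 0 < G i v then 1 else if G i v < 0 then 0 else s v
  have ht : ∀ i v, v ≠ 0 → t i (-v) = t i v + 1 := by
    intro i v hv
    have two : (1 : ZMod 2) + 1 = 0 := by decide
    simp only [t, hG i v hv, Left.neg_pos_iff, Left.neg_neg_iff]
    rcases lt_trichotomy (G i v) 0 with h | h | h
    · simp [h, not_lt.2 h.le]
    · simp [h, hs v hv]
    · simp [h, not_lt.2 h.le, two]
  -- finely subdivided hemispheres of the cross-polytope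
  let e : ℕ → E k := fun j => if hj : j < k then EuclideanSpace.single ⟨j, hj⟩ 1 else 0
  have he : ∀ j (hj : j < k), e j = EuclideanSpace.single ⟨j, hj⟩ (1 : ℝ) := fun j hj => by
    simp [e, hj]
  let 𝓚 : Set (Set (E k)) := {K | ∃ ε : Fin k → ℝ, (∀ i, |ε i| = 1) ∧ K = {v | ∑ i, ε i * v i = 1}}
  have hK : ∀ K ∈ 𝓚, Convex ℝ K := by
    rintro K ⟨ε, -, rfl⟩ v hv w hw a b - - hab
    simp only [Set.mem_ofPred_eq] at hv hw ⊢
    have : ∀ i, ε i * (a • v + b • w) i = a * (ε i * v i) + b * (ε i * w i) := fun i => by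
      simp; ring
    simp_rw [this, Finset.sum_add_distrib, ← Finset.mul_sum, hv, hw]
    simpa using hab
  have hK0 : ∀ K ∈ 𝓚, ∀ v ∈ K, 1 ≤ k * ‖v‖ := by
    rintro K ⟨ε, hε, rfl⟩ v hv
    have hv : ∑ i, ε i * v i = 1 := hv
    calc (1 : ℝ) = ∑ i, ε i * v i := hv.symm
      _ ≤ ∑ i : Fin k, ‖v‖ := Finset.sum_le_sum fun i _ => by
          refine (le_abs_self _).trans ?_
          rw [abs_mul, hε, one_mul]
          exact PiLp.norm_apply_le v i
      _ = _ := by simp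
  have hne : ∀ v : E k, 1 ≤ k * ‖v‖ → v ≠ 0 := by
    rintro v hv rfl
    norm_num at hv
  obtain ⟨r, hr⟩ : ∃ r : ℕ, (1 - (k : ℝ)⁻¹) ^ r * 2 < δ / (2 * k) := by
    have hq : 0 ≤ 1 - (k : ℝ)⁻¹ := sub_nonneg.2 (Nat.cast_inv_le_one k)
    have hq1 : 1 - (k : ℝ)⁻¹ < 1 := by
      have : 0 < (k : ℝ)⁻¹ := by positivity
      linarith
    obtain ⟨r, hr⟩ := exists_pow_lt_of_lt_one (show 0 < δ / (2 * k) / 2 by positivity) hq1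
    exact ⟨r, by linarith⟩
  let h : ℕ → Chain (E k) := fun j => (subdivide (j + 1))^[r] (cone (e j) (crossPolytope e j))
  have hh : ∀ j < k, h j ∈ chainsOf fun l => l.length = j + 1 ∧ (∃ K ∈ 𝓚, ∀ v ∈ l, v ∈ K) ∧
      ∀ v ∈ l, ∀ w ∈ l, dist v w ≤ (1 - (k : ℝ)⁻¹) ^ r * 2 := by
    intro j hj
    refine subdivide_pow_mem (by omega) 𝓚 hK zero_le_two ?_ r
    have h1 : cone (e j) (crossPolytope e j) ∈ chainsOf fun l => l.length = j + 1 ∧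
        ∃ ε : Fin k → ℝ, (∀ i, |ε i| = 1) ∧ ∀ v ∈ l, ‖v‖ ≤ 1 ∧ ∑ i, ε i * v i = 1 := by
      refine cone_mem_chainsOf _ (fun l ⟨hl, ε, hε, h⟩ => ⟨by simp [hl],
        Function.update ε ⟨j, hj⟩ 1, fun i => ?_, fun v hv => ?_⟩)
        (crossPolytope_mem k e he j (by omega))
      · by_cases hi : i = ⟨j, hj⟩
        · subst hi; simp
        · simpa [hi] using hε i
      · rcases List.mem_cons.1 hv with rfl | hv
        · rw [he j hj]
          refine ⟨by simp, ?_⟩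
          rw [Finset.sum_eq_single ⟨j, hj⟩]
          · simp
          · intro i _ hi; simp [hi]
          · simp
        · obtain ⟨h1, h2, h3⟩ := h v hv
          refine ⟨h1, ?_⟩
          rw [← h2]
          refine Finset.sum_congr rfl fun i _ => ?_
          by_cases hi : i = ⟨j, hj⟩
          · subst hi; simp [h3 ⟨j, hj⟩ le_rfl]
          · simp [hi]
    refine chainsOf_mono (fun l ⟨hl, ε, hε, h⟩ => ⟨hl, ?_, ?_⟩) h1
    · exact ⟨_, ⟨ε, hε, rfl⟩, fun v hv => (h v hv).2⟩
    · intro v hv w hw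
      rw [dist_eq_norm]
      have := norm_sub_le v w
      linarith [(h v hv).1, (h w hw).1]
  have hb : ∀ j < l, boundary (h (j + 1)) = h j + mapChain Neg.neg (h j) := by
    intro j _
    have h1 : ∀ (r m : ℕ) (c : Chain (E k)),
        boundary ((subdivide (m + 1))^[r] c) = (subdivide m)^[r] (boundary c) := by
      intro r m
      induction r with
      | zero => intro c; rfl
      | succ r ih => intro c; rw [Function.iterate_succ_apply, ih, boundary_subdivide]; rfl
    have h2 : ∀ (r m : ℕ) (c : Chain (E k)), (subdivide m)^[r] (c + mapChain Neg.neg c) =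
        (subdivide m)^[r] c + mapChain Neg.neg ((subdivide m)^[r] c) := by
      intro r m
      induction r with
      | zero => intro c; rfl
      | succ r ih =>
        intro c
        rw [Function.iterate_succ_apply, map_add, ← subdivide_neg, ih]; rfl
    simp only [h]
    rw [h1, boundary_cone_crossPolytope, h2]
  have hzero : ∀ i, cup t i (h 0) = 1 := by
    intro i
    have h1 : h 0 = Finsupp.single [e 0] 1 := by
      have h2 : subdivide 1 (Finsupp.single [e 0] (1 : ZMod 2)) = Finsupp.single [e 0] 1 := by
        rw [show (1 : ℕ) = 0 + 1 from rfl, subdivide_succ_single]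
        simp [simplexBoundary, subdivide, barycenter]
      simp only [h, crossPolytope, cone_single, zero_add]
      exact Function.iterate_fixed h2 r
    rw [h1]
    simp [cupSimplex]
  have hone := cup_hemisphere ht h l (fun j hj => chainsOf_mono
    (fun L ⟨h1, ⟨K, hK1, hK2⟩, h3⟩ => ⟨h1, fun v hv => hne v (hK0 K hK1 v (hK2 v hv))⟩)
    (hh j (by omega))) hb hzero l le_rfl 0
  -- on each small simplex, some coordinate of `f` does not change sign
  have hvan : cup t 0 (h l) = (0 : Chain (E k) →ₗ[ZMod 2] ZMod 2) (h l) := by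
    refine functional_eq_on _ _ ?_ (hh l hlk)
    rintro L ⟨h1, ⟨K, hK1, hK2⟩, h3⟩
    obtain ⟨v, hv⟩ : ∃ v, v ∈ L := List.exists_mem_of_length_pos (by omega)
    have hv1 := hK0 K hK1 v (hK2 v hv)
    obtain ⟨i, hi⟩ : ∃ i, c ≤ |f (‖v‖⁻¹ • v) i| := by
      by_contra! hcon
      exact absurd (hcf _ (hnorm v (hne v hv1))) (not_le.2 ((pi_norm_lt_iff hc).2 hcon))
    have hGw : ∀ w ∈ L, |G i w - G i v| < c := by
      intro w hw
      have hw0 := hne w (hK0 K hK1 w (hK2 w hw))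
      have hd : dist (‖v‖⁻¹ • v) (‖w‖⁻¹ • w) < δ := by
        refine (hproj v w hv1 hw0).trans_lt ?_
        have := (h3 v hv w hw).trans_lt hr
        rw [lt_div_iff₀ (by positivity)] at this
        linarith
      have := hδf _ (hnorm v (hne v hv1)) _ (hnorm w hw0) hd
      have := (dist_le_pi_dist _ _ i).trans_lt this
      rw [dist_comm, Real.dist_eq] at this
      simpa [G, i.2] using this
    have hGv : c ≤ |G i v| := by simpa [G, i.2] using hi
    have htw : ∀ w ∈ L, t i w = t i v := by
      intro w hw
      have h4 := abs_lt.1 (hGw w hw)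
      simp only [t]
      rcases le_abs.1 hGv with h5 | h5
      · rw [if_pos (by linarith), if_pos (by linarith)]
      · rw [if_neg (by linarith), if_pos (by linarith), if_neg (by linarith), if_pos (by linarith)]
    simp only [cup_single, one_mul, LinearMap.zero_apply]
    refine cupSimplex_eq_zero t i 0 L (by rw [h1]; omega) ?_
    simp only [zero_add]
    exact fun a ha b hb => (htw a ha).trans (htw b hb).symm
  rw [hone] at hvan
  simp at hvan

/-- The image of a sphere under a continuous odd map has genus at least the dimension of the
ambient space. -/
lemma le_genus_image_sphere {X : Type*} [TopologicalSpace X] [Neg X] {k : ℕ} (Φ : E k → X)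
    (hΦ : Continuous Φ) (hodd : ∀ c, Φ (-c) = -Φ c) :
    (k : ℕ∞) ≤ genus (Φ '' Metric.sphere 0 1) := by
  refine le_iInf fun l => le_iInf fun _ => le_iInf fun ⟨f, hf, h0, hneg⟩ => ?_
  refine Nat.cast_le.2 (borsuk_ulam (fun c => (f (Φ c)).ofLp) ?_ ?_ ?_)
  · exact (PiLp.continuous_ofLp 2 _).comp_continuousOn
      (hf.comp hΦ.continuousOn (Set.mapsTo_image _ _))
  · intro x hx h
    exact h0 _ (Set.mem_image_of_mem _ hx) (by ext i; exact congrFun h i)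
  · intro x hx
    simp only [hodd, hneg _ (Set.mem_image_of_mem Φ hx)]
    rfl

/-! ### Greedy selection of balls that carry a given mass -/

open Metric in
/-- Covering numbers of balls of `ℝⁿ` are bounded independently of the ball. -/
lemma exists_covering (n : ℕ) : ∃ C : ℕ, ∀ (x : E n) (r : ℝ), 0 < r →
    ∃ t : Finset (E n), t.card ≤ C ∧ ball x (12 * r) ⊆ ⋃ c ∈ t, ball c (r / 4) := by
  classical
  obtain ⟨t, -, ht⟩ := (isCompact_closedBall (0 : E n) 12).elim_nhds_subcover
    (fun c => ball c (1 / 4)) (fun c _ => ball_mem_nhds _ (by norm_num))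
  refine ⟨t.card, fun x r hr => ⟨t.image fun c => x + r • c, Finset.card_image_le, fun y hy => ?_⟩⟩
  have h1 : r⁻¹ • (y - x) ∈ closedBall (0 : E n) 12 := by
    rw [mem_closedBall_zero_iff, norm_smul, norm_inv, Real.norm_of_nonneg hr.le,
      inv_mul_le_iff₀ hr, mul_comm]
    exact (mem_ball_iff_norm.1 hy).le
  obtain ⟨c, hc, hcy⟩ := Set.mem_iUnion₂.1 (ht h1)
  refine Set.mem_iUnion₂.2 ⟨x + r • c, Finset.mem_image_of_mem _ hc, ?_⟩
  rw [mem_ball_iff_norm] at hcy ⊢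
  have : y - (x + r • c) = r • (r⁻¹ • (y - x) - c) := by
    rw [smul_sub, smul_inv_smul₀ hr.ne', sub_sub]
  rw [this, norm_smul, Real.norm_of_nonneg hr.le]
  calc r * _ < r * (1 / 4) := by gcongr
    _ = r / 4 := by ring

open Metric in
/-- A separated subset of a ball has boundedly many elements. -/
lemma card_le_of_separated {n C : ℕ} {ι : Type*} {x : E n} {r : ℝ} {t : Finset (E n)}
    (htC : t.card ≤ C) (ht : ball x (12 * r) ⊆ ⋃ c ∈ t, ball c (r / 4)) (s : Finset ι)
    (y : ι → E n) (hs : ∀ i ∈ s, y i ∈ ball x (12 * r))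
    (hsep : ∀ i ∈ s, ∀ j ∈ s, i ≠ j → r / 2 ≤ dist (y i) (y j)) : s.card ≤ C := by
  classical
  have h : ∀ i : s, ∃ c : t, y i ∈ ball (c : E n) (r / 4) := fun i => by
    obtain ⟨c, hc, h⟩ := Set.mem_iUnion₂.1 (ht (hs i i.2))
    exact ⟨⟨c, hc⟩, h⟩
  choose g hg using h
  have hinj : Function.Injective g := by
    intro i j hij
    by_contra hne
    have h1 := hsep i i.2 j j.2 fun h => hne (Subtype.ext h)
    have h2 := hg i
    have h3 := hg j
    rw [← hij] at h3
    have := dist_triangle_right (y i) (y j) (g i)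
    rw [mem_ball] at h2 h3
    linarith
  have := Fintype.card_le_of_injective g hinj
  simp only [Fintype.card_coe] at this
  exact this.trans htC

open Metric in
/-- A greedy selection of balls: each ball is chosen, up to a factor `2`, with the least radius for
which it has mass at least `τ` outside the eightfold enlargements of the balls chosen before. As
that enlargement has mass at most `C * τ`, the selection can be continued for `N` steps. -/
lemma exists_greedy_balls {n C : ℕ} (hC : ∀ (x : E n) (r : ℝ), 0 < r →
      ∃ t : Finset (E n), t.card ≤ C ∧ ball x (12 * r) ⊆ ⋃ c ∈ t, ball c (r / 4))
    (μ : Measure (E n)) [IsFiniteMeasure μ] {R : ℝ} (hR : μ (ball 0 R)ᶜ = 0) {τ : ℝ≥0∞} {ρ : ℝ}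
    (hρ : 0 < ρ) (hτ : ∀ x, μ (ball x ρ) < τ) {N : ℕ} (hN : N * (C * τ) + τ ≤ μ Set.univ) :
    ∃ (x : ℕ → E n) (r : ℕ → ℝ), (∀ j < N, ρ ≤ r j) ∧ (∀ j < N, ∀ i ≤ j, r i ≤ r j) ∧
      ∀ j < N, τ ≤ μ ((⋃ i < j, ball (x i) (8 * r i))ᶜ ∩ ball (x j) (r j)) := by
  classical
  have hchoice : ∀ S : Set (E n), ∃ q : E n × ℕ,
      (∃ (m : ℕ) (x : E n), τ ≤ μ (S ∩ ball x (2 ^ m * ρ))) →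
        τ ≤ μ (S ∩ ball q.1 (2 ^ q.2 * ρ)) ∧
        ∀ m < q.2, ∀ x, μ (S ∩ ball x (2 ^ m * ρ)) < τ := by
    intro S
    by_cases h : ∃ (m : ℕ) (x : E n), τ ≤ μ (S ∩ ball x (2 ^ m * ρ))
    · obtain ⟨x, hx⟩ := Nat.find_spec h
      refine ⟨(x, Nat.find h), fun _ => ⟨hx, fun m hm y => ?_⟩⟩
      have := Nat.find_min h hm
      push Not at this
      exact this y
    · exact ⟨(0, 0), fun h' => absurd h' h⟩
  choose q hq using hchoice
  -- `S j` is what is left when `j` balls have been chosen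
  let S : ℕ → Set (E n) := fun j => Nat.rec Set.univ
    (fun _ S => S \ ball (q S).1 (8 * (2 ^ (q S).2 * ρ))) j
  let x : ℕ → E n := fun j => (q (S j)).1
  let m : ℕ → ℕ := fun j => (q (S j)).2
  have hS : ∀ j, S (j + 1) = S j \ ball (x j) (8 * (2 ^ m j * ρ)) := fun j => rfl
  have hSeq : ∀ j, S j = (⋃ i < j, ball (x i) (8 * (2 ^ m i * ρ)))ᶜ := by
    intro j
    induction j with
    | zero => simp [S]
    | succ j ih =>
      rw [hS, ih, Set.biUnion_lt_succ, Set.compl_union, Set.sdiff_eq]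
  have hanti : Antitone S := antitone_nat_of_succ_le fun j => by
    rw [hS]; exact Set.sdiff_subset
  have hgood : ∀ T : Set (E n), τ ≤ μ T → ∃ (m : ℕ) (x : E n), τ ≤ μ (T ∩ ball x (2 ^ m * ρ)) := by
    intro T hT
    obtain ⟨m, hm⟩ := pow_unbounded_of_one_lt (R / ρ) (one_lt_two (α := ℝ))
    refine ⟨m, 0, hT.trans ?_⟩
    have hsub : T ⊆ (T ∩ ball 0 (2 ^ m * ρ)) ∪ (ball 0 R)ᶜ := by
      intro y hy
      by_cases h : y ∈ ball (0 : E n) R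
      · exact Or.inl ⟨hy, ball_subset_ball ((div_lt_iff₀ hρ).1 hm).le h⟩
      · exact Or.inr h
    calc μ T ≤ _ := measure_mono hsub
      _ ≤ _ := measure_union_le _ _
      _ = _ := by rw [hR, add_zero]
  have hfin : (N : ℝ≥0∞) * (C * τ) ≠ ⊤ :=
    ne_top_of_le_ne_top (measure_ne_top μ Set.univ) (le_self_add.trans hN)
  have hτS : ∀ j < N, μ Set.univ ≤ μ (S j) + j * (C * τ) → τ ≤ μ (S j) := by
    intro j hj h
    have h1 : (N : ℝ≥0∞) * (C * τ) + τ ≤ N * (C * τ) + μ (S j) := by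
      refine hN.trans (h.trans ?_)
      rw [add_comm]
      gcongr
    exact (ENNReal.add_le_add_iff_left hfin).1 h1
  have hmpos : ∀ j, τ ≤ μ (S j) → 0 < m j := by
    intro j hj
    by_contra h0
    have h0 : (q (S j)).2 = 0 := by simpa [m] using h0
    have h := (hq (S j) (hgood _ hj)).1
    rw [h0, pow_zero, one_mul] at h
    exact absurd ((h.trans (measure_mono Set.inter_subset_right)).trans_lt (hτ _)) (lt_irrefl _)
  have hmass : ∀ j ≤ N, μ Set.univ ≤ μ (S j) + j * (C * τ) := by
    intro j
    induction j with
    | zero => intro _; simp [S]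
    | succ j ih =>
      intro hj
      have ih := ih (by omega)
      have hτj := hτS j (by omega) ih
      obtain ⟨-, hmin⟩ := hq (S j) (hgood _ hτj)
      have hm1 := hmpos j hτj
      -- balls of half the radius of the chosen one have mass less than `τ`
      have hball : μ (S j ∩ ball (x j) (8 * (2 ^ m j * ρ))) ≤ C * τ := by
        obtain ⟨t, htC, ht⟩ := hC (x j) (2 ^ m j * ρ) (by positivity)
        have hsub : S j ∩ ball (x j) (8 * (2 ^ m j * ρ)) ⊆
            ⋃ c ∈ t, S j ∩ ball c (2 ^ (m j - 1) * ρ) := by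
          intro y hy
          obtain ⟨c, hc, hyc⟩ := Set.mem_iUnion₂.1
            (ht (ball_subset_ball (by gcongr; norm_num) hy.2))
          refine Set.mem_iUnion₂.2 ⟨c, hc, hy.1, ball_subset_ball ?_ hyc⟩
          have : (2 : ℝ) ^ m j = 2 ^ (m j - 1) * 2 := by
            rw [← pow_succ, Nat.sub_add_cancel hm1]
          rw [this]
          have : 0 < (2 : ℝ) ^ (m j - 1) * ρ := by positivity
          linarith
        calc _ ≤ _ := measure_mono hsub
          _ ≤ ∑ c ∈ t, μ (S j ∩ ball c (2 ^ (m j - 1) * ρ)) := measure_biUnion_finset_le _ _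
          _ ≤ ∑ c ∈ t, τ := Finset.sum_le_sum fun c _ => (hmin (m j - 1)
              (Nat.sub_lt hm1 one_pos) c).le
          _ = t.card * τ := by simp
          _ ≤ C * τ := by gcongr
      calc μ Set.univ ≤ μ (S j) + j * (C * τ) := ih
        _ ≤ (μ (S (j + 1)) + C * τ) + j * (C * τ) := by
            gcongr
            calc μ (S j) ≤ μ (S j ∩ ball (x j) (8 * (2 ^ m j * ρ))) +
                  μ (S j \ ball (x j) (8 * (2 ^ m j * ρ))) := measure_le_inter_add_sdiff _ _ _
              _ ≤ C * τ + μ (S (j + 1)) := by rw [hS]; gcongr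
              _ = _ := add_comm _ _
        _ = _ := by push_cast; ring
  have hfull : ∀ j < N, τ ≤ μ (S j) := fun j hj => hτS j hj (hmass j hj.le)
  refine ⟨x, fun j => 2 ^ m j * ρ, fun j _ => ?_, fun j hj i hi => ?_, fun j hj => ?_⟩
  · exact le_mul_of_one_le_left hρ.le (one_le_pow₀ one_le_two)
  · have : m i ≤ m j := by
      by_contra! hlt
      have h1 := (hq (S i) (hgood _ (hfull i (by omega)))).2 _ hlt (x j)
      have h2 := (hq (S j) (hgood _ (hfull j hj))).1
      exact absurd ((h2.trans (measure_mono (Set.inter_subset_inter_left _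
        (hanti hi)))).trans_lt h1) (lt_irrefl _)
    have : (2 : ℝ) ^ m i ≤ 2 ^ m j := pow_le_pow_right₀ one_le_two this
    show (2 : ℝ) ^ m i * ρ ≤ 2 ^ m j * ρ
    gcongr
  · rw [← hSeq]
    exact (hq (S j) (hgood _ (hfull j hj))).1

/-! ### The holes of a ball -/

section Holes

variable {n : ℕ} (x : ℕ → E n) (r : ℕ → ℝ)

/-- The ball `i` is absorbed by the later and much larger ball `l` near it: its fourfold enlargement
lies inside that of `l`. -/
def Absorbs (i l : ℕ) : Prop :=
  i < l ∧ dist (x i) (x l) < 8 * r i + 2 * r l ∧ 8 * r i ≤ r l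

open Classical in
/-- The earlier balls that have to be cut out of the ball `j`: those near it that no ball chosen in
between absorbs. -/
def holes (j : ℕ) : Finset ℕ :=
  (Finset.range j).filter fun i =>
    dist (x i) (x j) < 8 * r i + 2 * r j ∧ ∀ l, i < l → l < j → ¬ Absorbs x r i l

variable {x r}

lemma mem_holes {i j : ℕ} : i ∈ holes x r j ↔ i < j ∧ dist (x i) (x j) < 8 * r i + 2 * r j ∧
    ∀ l, i < l → l < j → ¬ Absorbs x r i l := by
  simp [holes]

open Metric in
lemma Absorbs.closedBall_subset {i l : ℕ} (h : Absorbs x r i l) (hi : 0 ≤ r i) :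
    closedBall (x i) (4 * r i) ⊆ closedBall (x l) (4 * r l) := by
  refine closedBall_subset_closedBall' ?_
  obtain ⟨-, h1, h2⟩ := h
  linarith

open Metric in
/-- Within twice the ball `j`, the fourfold enlargement of every earlier ball is covered by the
holes. -/
lemma inter_closedBall_subset_holes {N : ℕ} (hr : ∀ j < N, 0 < r j) {j : ℕ} (hj : j < N) (d : ℕ) :
    ∀ i, i + d = j → i < j → closedBall (x j) (2 * r j) ∩ closedBall (x i) (4 * r i) ⊆
      ⋃ l ∈ holes x r j, closedBall (x l) (4 * r l) := by
  induction d using Nat.strong_induction_on with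
  | _ d ih =>
    intro i hid hij y hy
    have hri := hr i (by omega)
    have hdist : dist (x i) (x j) < 8 * r i + 2 * r j := by
      have := dist_triangle_left (x i) (x j) y
      have h1 := mem_closedBall.1 hy.1
      have h2 := mem_closedBall.1 hy.2
      linarith
    by_cases h : i ∈ holes x r j
    · exact Set.mem_iUnion₂.2 ⟨i, h, hy.2⟩
    · rw [mem_holes] at h
      push Not at h
      obtain ⟨l, hil, hlj, hl⟩ := h hij hdist
      exact ih (j - l) (by omega) l (by omega) hlj ⟨hy.1, hl.closedBall_subset hri.le hy.2⟩

open Metric in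
/-- On average a ball has boundedly many holes. The holes much smaller than the ball are absorbed by
it, which happens to each ball only once; the other ones are of comparable size and separated. -/
lemma sum_card_holes_le {N C : ℕ} (hC : ∀ (x : E n) (r : ℝ), 0 < r →
      ∃ t : Finset (E n), t.card ≤ C ∧ ball x (12 * r) ⊆ ⋃ c ∈ t, ball c (r / 4))
    (hr : ∀ j < N, 0 < r j) (hmono : ∀ j < N, ∀ i ≤ j, r i ≤ r j)
    (hne : ∀ j < N, ((⋃ i < j, ball (x i) (8 * r i))ᶜ ∩ ball (x j) (r j)).Nonempty) :
    ∑ j ∈ Finset.range N, (holes x r j).card ≤ (C + 1) * N := by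
  classical
  have hy : ∀ j, ∃ y, j < N → y ∈ (⋃ i < j, ball (x i) (8 * r i))ᶜ ∩ ball (x j) (r j) := fun j => by
    by_cases hj : j < N
    · obtain ⟨y, hy⟩ := hne j hj
      exact ⟨y, fun _ => hy⟩
    · exact ⟨0, fun h => absurd h hj⟩
  choose y hy using hy
  have hlarge : ∀ j ∈ Finset.range N, ((holes x r j).filter fun i => ¬ 8 * r i ≤ r j).card ≤ C := by
    intro j hj
    have hj := Finset.mem_range.1 hj
    obtain ⟨t, htC, ht⟩ := hC (x j) (r j) (hr j hj)
    refine card_le_of_separated htC ht _ y (fun i hi => ?_) ?_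
    · obtain ⟨hi, -⟩ := Finset.mem_filter.1 hi
      obtain ⟨hij, hd, -⟩ := mem_holes.1 hi
      have h1 := mem_ball.1 (hy i (by omega)).2
      have h2 := hmono j hj i hij.le
      have h3 := dist_triangle (y i) (x i) (x j)
      have := hr j hj
      rw [mem_ball]
      linarith
    · have key : ∀ i ∈ (holes x r j).filter fun i => ¬ 8 * r i ≤ r j,
          ∀ i' ∈ (holes x r j).filter fun i => ¬ 8 * r i ≤ r j, i < i' →
            r j / 2 ≤ dist (y i) (y i') := by
        intro i hi i' hi' hlt
        obtain ⟨hi, hri⟩ := Finset.mem_filter.1 hi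
        obtain ⟨hi', -⟩ := Finset.mem_filter.1 hi'
        have hij := (mem_holes.1 hi).1
        have hij' := (mem_holes.1 hi').1
        have h1 := mem_ball.1 (hy i (by omega)).2
        have h2 : 8 * r i ≤ dist (y i') (x i) := by
          by_contra! hcon
          exact (hy i' (by omega)).1 (Set.mem_iUnion₂.2 ⟨i, hlt, hcon⟩)
        have h3 := dist_triangle_left (y i') (x i) (y i)
        have := hr j hj
        linarith
      intro i hi i' hi' hne
      rcases lt_or_gt_of_ne hne with h | h
      · exact key i hi i' hi' h
      · rw [dist_comm]; exact key i' hi' i hi h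
  have hsmall : ∑ j ∈ Finset.range N, ((holes x r j).filter fun i => 8 * r i ≤ r j).card ≤ N := by
    have hcard : ∀ j ∈ Finset.range N, ((holes x r j).filter fun i => 8 * r i ≤ r j).card =
        ((Finset.range N).filter fun i => i ∈ holes x r j ∧ 8 * r i ≤ r j).card := by
      intro j hj
      congr 1
      ext i
      simp only [Finset.mem_filter, Finset.mem_range]
      refine ⟨fun h => ⟨?_, h⟩, fun h => h.2⟩
      have := (mem_holes.1 h.1).1
      have := Finset.mem_range.1 hj
      omega
    rw [Finset.sum_congr rfl hcard]
    have := Finset.sum_card_bipartiteAbove_eq_sum_card_bipartiteBelow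
      (s := Finset.range N) (t := Finset.range N)
      (fun j i => i ∈ holes x r j ∧ 8 * r i ≤ r j)
    simp only [Finset.bipartiteAbove, Finset.bipartiteBelow] at this
    rw [this]
    calc _ ≤ ∑ i ∈ Finset.range N, 1 := Finset.sum_le_sum fun i _ => ?_
      _ = N := by simp
    rw [Finset.card_le_one]
    have key : ∀ j j', j < j' → (i ∈ holes x r j ∧ 8 * r i ≤ r j) →
        (i ∈ holes x r j' ∧ 8 * r i ≤ r j') → False := by
      rintro j j' hlt ⟨h1, h2⟩ ⟨h3, -⟩
      have h1 := mem_holes.1 h1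
      exact (mem_holes.1 h3).2.2 j h1.1 hlt ⟨h1.1, h1.2.1, h2⟩
    intro j hj j' hj'
    have hj := (Finset.mem_filter.1 hj).2
    have hj' := (Finset.mem_filter.1 hj').2
    rcases lt_trichotomy j j' with h | h | h
    · exact (key _ _ h hj hj').elim
    · exact h
    · exact (key _ _ h hj' hj).elim
  calc _ = ∑ j ∈ Finset.range N, (((holes x r j).filter fun i => 8 * r i ≤ r j).card +
        ((holes x r j).filter fun i => ¬ 8 * r i ≤ r j).card) :=
        Finset.sum_congr rfl fun j _ => (Finset.card_filter_add_card_filter_not _).symm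
    _ ≤ N + ∑ j ∈ Finset.range N, C := by
        rw [Finset.sum_add_distrib]
        exact add_le_add hsmall (Finset.sum_le_sum hlarge)
    _ = _ := by simp; ring

end Holes

/-! ### Cutoff functions and the test functions -/

/-- There are smooth cutoff functions at every center and scale, with scale-invariant bounds. -/
lemma exists_cutoff (n : ℕ) : ∃ L : ℝ, 0 < L ∧ ∃ ψ : E n → ℝ → E n → ℝ, ∀ x r, 0 < r →
    ContDiff ℝ ∞ (ψ x r) ∧ (∀ y, 0 ≤ ψ x r y ∧ ψ x r y ≤ 1) ∧
    (∀ y ∈ Metric.closedBall x r, ψ x r y = 1) ∧ (∀ y, 2 * r ≤ dist y x → ψ x r y = 0) ∧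
    (∀ y, ‖fderiv ℝ (ψ x r) y‖ ≤ (Metric.closedBall x (2 * r)).indicator (fun _ => L / r) y) := by
  let f : ContDiffBump (0 : E n) := ⟨1, 2, one_pos, one_lt_two⟩
  have hf : ContDiff ℝ ∞ f := f.contDiff
  obtain ⟨L, hL⟩ := (hf.continuous_fderiv (by simp)).bounded_above_of_compact_support
    (f.hasCompactSupport.fderiv ℝ)
  refine ⟨max L 1, by positivity, fun x r y => f (r⁻¹ • (y - x)), fun x r hr => ?_⟩
  have hnorm : ∀ y, dist (r⁻¹ • (y - x)) 0 = r⁻¹ * dist y x := fun y => by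
    rw [dist_zero_right, norm_smul, norm_inv, Real.norm_of_nonneg hr.le, dist_eq_norm]
  have hzero : ∀ y, 2 * r ≤ dist y x → f (r⁻¹ • (y - x)) = 0 := fun y hy => by
    refine f.zero_of_le_dist ?_
    rw [hnorm, ← div_eq_inv_mul, le_div_iff₀ hr]
    exact hy
  have hsm : ContDiff ℝ ∞ fun y => f (r⁻¹ • (y - x)) :=
    hf.comp ((contDiff_id.sub contDiff_const).const_smul _)
  refine ⟨hsm, fun y => ⟨f.nonneg, f.le_one⟩, fun y hy => ?_, hzero, fun y => ?_⟩
  · refine f.one_of_mem_closedBall ?_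
    rw [Metric.mem_closedBall, hnorm, ← div_eq_inv_mul]
    exact (div_le_one₀ hr).2 hy
  · by_cases hy : y ∈ Metric.closedBall x (2 * r)
    · rw [Set.indicator_of_mem hy]
      have h1 : HasFDerivAt (fun y => f (r⁻¹ • (y - x)))
          ((fderiv ℝ f (r⁻¹ • (y - x))).comp (r⁻¹ • ContinuousLinearMap.id ℝ (E n))) y := by
        have h2 : HasFDerivAt (fun y => r⁻¹ • (y - x)) (r⁻¹ • ContinuousLinearMap.id ℝ (E n)) y :=
          ((hasFDerivAt_id y).sub_const x).fun_const_smul _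
        exact ((hf.differentiable (by simp)) _).hasFDerivAt.comp y h2
      rw [h1.fderiv, ContinuousLinearMap.comp_smul, ContinuousLinearMap.comp_id, norm_smul,
        norm_inv, Real.norm_of_nonneg hr.le, div_eq_inv_mul]
      gcongr
      exact (hL _).trans (le_max_left _ _)
    · rw [Set.indicator_of_notMem hy]
      have h1 : (fun y => f (r⁻¹ • (y - x))) =ᶠ[𝓝 y] fun _ => (0 : ℝ) := by
        filter_upwards [Metric.isClosed_closedBall.isOpen_compl.mem_nhds hy] with z hz
        exact hzero z (not_le.1 fun h => hz (Metric.mem_closedBall.2 h)).le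
      rw [h1.fderiv_eq]
      simp

lemma norm_fderiv_prod_le {n : ℕ} {ι : Type*} (s : Finset ι) (f : ι → E n → ℝ)
    (hf : ∀ i ∈ s, Differentiable ℝ (f i)) (h01 : ∀ i ∈ s, ∀ y, 0 ≤ f i y ∧ f i y ≤ 1) (y : E n) :
    ‖fderiv ℝ (fun y => ∏ i ∈ s, f i y) y‖ ≤ ∑ i ∈ s, ‖fderiv ℝ (f i) y‖ := by
  classical
  rw [fderiv_finsetProd fun i hi => hf i hi y]
  refine (norm_sum_le _ _).trans (Finset.sum_le_sum fun i hi => ?_)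
  rw [norm_smul]
  refine mul_le_of_le_one_left (norm_nonneg _) ?_
  have h0 : ∀ j ∈ s.erase i, 0 ≤ f j y ∧ f j y ≤ 1 := fun j hj =>
    h01 j (Finset.mem_of_mem_erase hj) y
  rw [Real.norm_of_nonneg (Finset.prod_nonneg fun j hj => (h0 j hj).1)]
  exact Finset.prod_le_one (fun j hj => (h0 j hj).1) fun j hj => (h0 j hj).2

open Metric in
/-- Test functions for a finite measure `μ`: if the balls of radius `ρ` have mass less than `τ`,
there are about `μ(ℝⁿ) / τ` smooth functions with disjoint supports, each equal to `1` on a set of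
mass at least `τ`, whose gradients are controlled by, on average, boundedly many balls of radii at
least `ρ`. -/
theorem exists_test_functions (n : ℕ) : ∃ (C : ℕ) (L : ℝ), 0 < L ∧
    ∀ (μ : Measure (E n)) [IsFiniteMeasure μ] (R : ℝ), μ (ball 0 R)ᶜ = 0 →
    ∀ (τ : ℝ≥0∞) (ρ : ℝ), 0 < ρ → (∀ x, μ (ball x ρ) < τ) →
    ∀ N : ℕ, N * (C * τ) + τ ≤ μ Set.univ →
    ∃ (u : ℕ → E n → ℝ) (B : ℕ → Finset ℕ) (z : ℕ → ℕ → E n) (s : ℕ → ℕ → ℝ),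
      (∀ j < N, ContDiff ℝ ∞ (u j) ∧ HasCompactSupport (u j) ∧ (∀ y, 0 ≤ u j y) ∧
        τ ≤ μ {y | u j y = 1} ∧ (∀ i ∈ B j, ρ ≤ s j i) ∧
        ∀ y, ‖fderiv ℝ (u j) y‖ ≤
          ∑ i ∈ B j, (closedBall (z j i) (2 * s j i)).indicator (fun _ => L / s j i) y) ∧
      (∀ j < N, ∀ i < j, Disjoint (Function.support (u i)) (Function.support (u j))) ∧
      ∑ j ∈ Finset.range N, (B j).card ≤ (C + 2) * N := by
  classical
  obtain ⟨C, hC⟩ := exists_covering n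
  obtain ⟨L, hL, ψ, hψ⟩ := exists_cutoff n
  refine ⟨C, L, hL, fun μ _ R hR τ ρ hρ hτ N hN => ?_⟩
  obtain ⟨x, r, hρr, hmono, hmass⟩ := exists_greedy_balls hC μ hR hρ hτ hN
  have hr : ∀ j < N, 0 < r j := fun j hj => hρ.trans_le (hρr j hj)
  have hτ0 : 0 < τ := pos_of_gt (hτ 0)
  have hcount := sum_card_holes_le hC hr hmono fun j hj =>
    nonempty_of_measure_ne_zero (hτ0.trans_le (hmass j hj)).ne'
  -- `u j` is a cutoff to the ball `j` times cutoffs that vanish on the fourfold enlargements of its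
  -- holes and are `1` outside the eightfold ones, where the mass of the ball `j` sits
  let g : ℕ → ℕ → E n → ℝ := fun j i => if i = j then ψ (x j) (r j) else
    fun y => 1 - ψ (x i) (4 * r i) y
  have hjH : ∀ j, j ∉ holes x r j := fun j h => lt_irrefl _ (mem_holes.1 h).1
  have hgeq : ∀ j y, ∏ i ∈ insert j (holes x r j), g j i y =
      ψ (x j) (r j) y * ∏ i ∈ holes x r j, (1 - ψ (x i) (4 * r i) y) := by
    intro j y
    rw [Finset.prod_insert (hjH j)]
    congr 1
    · simp [g]
    · refine Finset.prod_congr rfl fun i hi => ?_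
      have : i ≠ j := by rintro rfl; exact hjH _ hi
      simp [g, this]
  have hg : ∀ j < N, ∀ i ∈ insert j (holes x r j), ContDiff ℝ ∞ (g j i) ∧
      ∀ y, 0 ≤ g j i y ∧ g j i y ≤ 1 := by
    intro j hj i hi
    by_cases hij : i = j
    · subst hij
      have := hψ (x i) (r i) (hr i hj)
      simp only [g, if_true]
      exact ⟨this.1, this.2.1⟩
    · have hi := Finset.mem_of_mem_insert_of_ne hi hij
      have hiN : i < N := (mem_holes.1 hi).1.trans hj
      have := hψ (x i) (4 * r i) (mul_pos four_pos (hr i hiN))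
      simp only [g, if_neg hij]
      exact ⟨contDiff_const.sub this.1, fun y => by
        have := this.2.1 y
        constructor <;> linarith⟩
  let u : ℕ → E n → ℝ := fun j y => ∏ i ∈ insert j (holes x r j), g j i y
  have hsupp : ∀ j < N, ∀ y, u j y ≠ 0 → y ∈ ball (x j) (2 * r j) ∧
      ∀ i ∈ holes x r j, y ∉ closedBall (x i) (4 * r i) := by
    intro j hj y hy
    simp only [u, hgeq] at hy
    refine ⟨?_, fun i hi hyi => ?_⟩
    · by_contra h
      rw [mem_ball, not_lt] at h
      exact hy (by rw [(hψ (x j) (r j) (hr j hj)).2.2.2.1 y h, zero_mul])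
    · have hiN : i < N := (mem_holes.1 hi).1.trans hj
      have := (hψ (x i) (4 * r i) (mul_pos four_pos (hr i hiN))).2.2.1 y hyi
      exact hy (by rw [Finset.prod_eq_zero hi (by rw [this, sub_self]), mul_zero])
  let s : ℕ → ℕ → ℝ := fun j i => if i = j then r j else 4 * r i
  refine ⟨u, fun j => insert j (holes x r j), fun _ i => x i, s,
    fun j hj => ⟨?_, ?_, ?_, ?_, ?_, ?_⟩, ?_, ?_⟩
  · exact contDiff_prod fun i hi => (hg j hj i hi).1
  · refine HasCompactSupport.intro (isCompact_closedBall (x j) (2 * r j)) fun y hy => ?_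
    by_contra h
    exact hy (ball_subset_closedBall (hsupp j hj y h).1)
  · exact fun y => Finset.prod_nonneg fun i hi => ((hg j hj i hi).2 y).1
  · refine (hmass j hj).trans (measure_mono fun y hy => ?_)
    show u j y = 1
    simp only [u, hgeq]
    rw [(hψ (x j) (r j) (hr j hj)).2.2.1 y (ball_subset_closedBall hy.2), one_mul]
    refine Finset.prod_eq_one fun i hi => ?_
    have hij := (mem_holes.1 hi).1
    rw [(hψ (x i) (4 * r i) (mul_pos four_pos (hr i (hij.trans hj)))).2.2.2.1 y, sub_zero]
    by_contra! hlt
    exact hy.1 (Set.mem_iUnion₂.2 ⟨i, hij, by rw [mem_ball]; linarith⟩)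
  · intro i hi
    by_cases hij : i = j
    · simpa [s, hij] using hρr j hj
    · have hi := Finset.mem_of_mem_insert_of_ne hi hij
      have hiN : i < N := (mem_holes.1 hi).1.trans hj
      have h1 := hρr i hiN
      have h2 := hr i hiN
      simp only [s, hij, if_false]
      linarith
  · intro y
    refine (norm_fderiv_prod_le _ _ (fun i hi => (hg j hj i hi).1.differentiable (by simp))
      (fun i hi => (hg j hj i hi).2) y).trans (Finset.sum_le_sum fun i hi => ?_)
    by_cases hij : i = j
    · subst hij
      simpa [g, s] using (hψ (x i) (r i) (hr i hj)).2.2.2.2 y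
    · have hi := Finset.mem_of_mem_insert_of_ne hi hij
      have hiN : i < N := (mem_holes.1 hi).1.trans hj
      have := (hψ (x i) (4 * r i) (mul_pos four_pos (hr i hiN))).2.2.2.2 y
      simp only [g, s, hij, if_false]
      rw [fderiv_const_sub, norm_neg]
      exact this
  · intro j hj i hij
    rw [Set.disjoint_left]
    intro y hyi hyj
    obtain ⟨h1, h2⟩ := hsupp j hj y hyj
    obtain ⟨h3, -⟩ := hsupp i (hij.trans hj) y hyi
    have hri := hr i (hij.trans hj)
    obtain ⟨l, hl, hyl⟩ := Set.mem_iUnion₂.1 (inter_closedBall_subset_holes hr hj (j - i) i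
      (by omega) hij ⟨ball_subset_closedBall h1, closedBall_subset_closedBall (by linarith)
        (ball_subset_closedBall h3)⟩)
    exact h2 l hl hyl
  · calc _ ≤ ∑ j ∈ Finset.range N, ((holes x r j).card + 1) := Finset.sum_le_sum fun j _ =>
          Finset.card_insert_le _ _
      _ ≤ (C + 1) * N + N := by
          rw [Finset.sum_add_distrib]
          simpa using hcount
      _ = _ := by ring

/-! ### Surface measure of Lipschitz boundaries -/

section Graph

variable {n : ℕ} (e : E n)

/-- The graph map of a function on the hyperplane orthogonal to `e`. -/
def graphMap (g : (ℝ ∙ e)ᗮ → ℝ) (z : (ℝ ∙ e)ᗮ) : E n := z + g z • e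

variable {e}

lemma orthogonal_decomposition (he : ‖e‖ = 1) (y : E n) :
    ((ℝ ∙ e)ᗮ.orthogonalProjectionOnto y : E n) + inner ℝ e y • e = y := by
  have := Submodule.starProjection_add_starProjection_orthogonal (K := ℝ ∙ e) y
  rw [Submodule.starProjection_unit_singleton ℝ he, add_comm] at this
  exact this

lemma inner_orthogonal (z : (ℝ ∙ e)ᗮ) : inner ℝ e (z : E n) = 0 :=
  Submodule.mem_orthogonal_singleton_iff_inner_right.1 z.2

lemma orthogonalProjectionOnto_self :
    (ℝ ∙ e)ᗮ.orthogonalProjectionOnto e = 0 :=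
  Submodule.orthogonalProjectionOnto_orthogonal_apply_eq_zero (Submodule.mem_span_singleton_self e)

lemma orthogonalProjectionOnto_add_smul (z : (ℝ ∙ e)ᗮ) (t : ℝ) :
    (ℝ ∙ e)ᗮ.orthogonalProjectionOnto ((z : E n) + t • e) = z := by
  rw [map_add, map_smul, orthogonalProjectionOnto_self, smul_zero, add_zero,
    Submodule.orthogonalProjectionOnto_mem_subspace_eq_self]

lemma inner_add_smul (he : ‖e‖ = 1) (z : (ℝ ∙ e)ᗮ) (t : ℝ) :
    inner ℝ e ((z : E n) + t • e) = t := by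
  rw [inner_add_right, inner_orthogonal, inner_smul_right, real_inner_self_eq_norm_sq, he]
  simp

/-- Orthogonal coordinates: the height in direction `e`, and the projection to the hyperplane. -/
def orthogonalCoordinates (he : ‖e‖ = 1) : ((ℝ ∙ e)ᗮ × ℝ) ≃ₗ[ℝ] E n where
  toFun q := q.1 + q.2 • e
  invFun y := ((ℝ ∙ e)ᗮ.orthogonalProjectionOnto y, inner ℝ e y)
  map_add' p q := by simp only [Prod.fst_add, Prod.snd_add, Submodule.coe_add, add_smul]; abel
  map_smul' c q := by simp [smul_smul]
  left_inv q := by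
    simp only [orthogonalProjectionOnto_add_smul, inner_add_smul he]
  right_inv y := orthogonal_decomposition he y

/-- Fubini's theorem in orthogonal coordinates, up to the normalization of the measures. -/
lemma exists_lintegral_orthogonal_le (he : ‖e‖ = 1) : ∃ c : ℝ≥0, ∀ h : E n → ℝ≥0∞, Measurable h →
    ∫⁻ z : (ℝ ∙ e)ᗮ, ∫⁻ t : ℝ, h (z + t • e) ≤ c * ∫⁻ y, h y := by
  let A : ((ℝ ∙ e)ᗮ × ℝ) ≃L[ℝ] E n := (orthogonalCoordinates he).toContinuousLinearEquiv
  let ν : Measure (E n) := Measure.map A (volume.prod volume)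
  have : ν.IsAddHaarMeasure := A.isAddHaarMeasure_map _
  have hν := Measure.isAddLeftInvariant_eq_smul ν (volume : Measure (E n))
  refine ⟨ν.addHaarScalarFactor volume, fun h hh => le_of_eq ?_⟩
  have h1 : ∫⁻ y, h y ∂ν = ∫⁻ z : (ℝ ∙ e)ᗮ, ∫⁻ t : ℝ, h (z + t • e) := by
    rw [lintegral_map hh A.continuous.measurable, lintegral_prod]
    · rfl
    · exact (hh.comp A.continuous.measurable).aemeasurable
  rw [← h1]
  calc ∫⁻ y, h y ∂ν = ∫⁻ y, h y ∂(ν.addHaarScalarFactor volume • volume) :=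
        congrArg (lintegral · h) hν
    _ = _ := lintegral_smul_measure _ _

variable {g : (ℝ ∙ e)ᗮ → ℝ} {K : ℝ≥0}

lemma lipschitzWith_graphMap (he : ‖e‖ = 1) (hg : LipschitzWith K g) :
    LipschitzWith (1 + K) (graphMap e g) := by
  have h1 : LipschitzWith 1 fun z : (ℝ ∙ e)ᗮ => (z : E n) := LipschitzWith.subtype_val _
  have h2 : LipschitzWith K fun z => g z • e := by
    refine LipschitzWith.of_dist_le_mul fun z w => ?_
    rw [dist_eq_norm, ← sub_smul, norm_smul, he, mul_one, ← dist_eq_norm]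
    exact hg.dist_le_mul z w
  exact h1.add h2

/-- The surface measure of a piece of a Lipschitz graph is controlled by the Lebesgue measure of its
projection. -/
lemma euclideanHausdorffMeasure_graph_le (hn : 1 ≤ n) (he : ‖e‖ = 1) (hg : LipschitzWith K g)
    {A : Set (E n)} (hA : ∀ y ∈ A, inner ℝ e y = g ((ℝ ∙ e)ᗮ.orthogonalProjectionOnto y)) :
    (Measure.euclideanHausdorffMeasure (n - 1) : Measure (E n)) A ≤
      (1 + K : ℝ≥0) ^ (n - 1) * volume (graphMap e g ⁻¹' A) := by
  have hfin : Fact (Module.finrank ℝ (E n) = (n - 1) + 1) := ⟨by simp; omega⟩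
  have hH : Module.finrank ℝ (ℝ ∙ e)ᗮ = n - 1 :=
    Submodule.finrank_orthogonal_span_singleton (by rintro rfl; simp at he)
  have hsub : A ⊆ graphMap e g '' (graphMap e g ⁻¹' A) := by
    intro y hy
    have hy' : graphMap e g ((ℝ ∙ e)ᗮ.orthogonalProjectionOnto y) = y := by
      rw [graphMap, ← hA y hy]
      exact orthogonal_decomposition he y
    exact ⟨_, by rw [Set.mem_preimage, hy']; exact hy, hy'⟩
  have hvol := InnerProductSpace.euclideanHausdorffMeasure_eq_volume (V := (ℝ ∙ e)ᗮ)
  rw [hH] at hvol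
  refine (measure_mono hsub).trans ?_
  rw [← hvol, Measure.euclideanHausdorffMeasure_def, Measure.euclideanHausdorffMeasure_def,
    Measure.smul_apply, Measure.smul_apply, mul_smul_comm]
  gcongr
  have := (lipschitzWith_graphMap he hg).hausdorffMeasure_image_le (Nat.cast_nonneg (n - 1))
    (graphMap e g ⁻¹' A)
  rwa [ENNReal.rpow_natCast] at this

end Graph

section Patch

variable {n : ℕ} {Ω : Set (E n)}

/-- `Ω` is, in the ball `B(x, 2δ)`, the open region above the graph of `g` in direction `e`. -/
structure IsGraphPatch (Ω : Set (E n)) (x : E n) (δ : ℝ) (e : E n) (K : ℝ≥0)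
    (g : (ℝ ∙ e)ᗮ → ℝ) : Prop where
  pos : 0 < δ
  norm_eq : ‖e‖ = 1
  lipschitz : LipschitzWith K g
  mem_iff : ∀ y ∈ Metric.ball x (2 * δ),
    (y ∈ Ω ↔ g ((ℝ ∙ e)ᗮ.orthogonalProjectionOnto y) < inner ℝ e y)

lemma HasLipschitzBoundary.exists_patch (h : HasLipschitzBoundary Ω) {x : E n}
    (hx : x ∈ frontier Ω) : ∃ δ e K g, IsGraphPatch Ω x δ e K g := by
  obtain ⟨e, he, K, g, hg, U, hU, hUm⟩ := h x hx
  obtain ⟨ε, hε, hεU⟩ := Metric.mem_nhds_iff.1 hU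
  refine ⟨ε / 2, e, K, g, half_pos hε, he, hg, fun y hy => hUm y (hεU ?_)⟩
  rwa [mul_div_cancel₀ ε two_ne_zero] at hy

variable {x : E n} {δ : ℝ} {e : E n} {K : ℝ≥0} {g : (ℝ ∙ e)ᗮ → ℝ}

lemma IsGraphPatch.inner_eq (h : IsGraphPatch Ω x δ e K g) (hΩ : IsOpen Ω) {y : E n}
    (hy : y ∈ frontier Ω) (hyx : y ∈ Metric.ball x (2 * δ)) :
    inner ℝ e y = g ((ℝ ∙ e)ᗮ.orthogonalProjectionOnto y) := by
  rw [hΩ.frontier_eq] at hy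
  refine le_antisymm (not_lt.1 fun hlt => hy.2 ((h.mem_iff y hyx).2 hlt)) (not_lt.1 fun hlt => ?_)
  have hc : Continuous fun y : E n => g ((ℝ ∙ e)ᗮ.orthogonalProjectionOnto y) :=
    h.lipschitz.continuous.comp (ContinuousLinearMap.continuous _)
  have hi : Continuous fun y : E n => inner ℝ e y := continuous_const.inner continuous_id
  have hopen : IsOpen ({y : E n | inner ℝ e y < g ((ℝ ∙ e)ᗮ.orthogonalProjectionOnto y)} ∩
      Metric.ball x (2 * δ)) := (isOpen_lt hi hc).inter Metric.isOpen_ball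
  obtain ⟨w, ⟨hw1, hw2⟩, hwΩ⟩ := mem_closure_iff.1 hy.1 _ hopen ⟨hlt, hyx⟩
  exact lt_asymm hw1 ((h.mem_iff w hw2).1 hwΩ)

lemma IsGraphPatch.add_smul_mem (h : IsGraphPatch Ω x δ e K g) (hΩ : IsOpen Ω) {y : E n}
    (hy : y ∈ frontier Ω) (hyx : y ∈ Metric.ball x δ) {t : ℝ} (ht : t ∈ Set.Ioo 0 δ) :
    y + t • e ∈ Ω := by
  have hb : Metric.ball x δ ⊆ Metric.ball x (2 * δ) :=
    Metric.ball_subset_ball (by linarith [h.pos])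
  have hmem : y + t • e ∈ Metric.ball x (2 * δ) := by
    have h1 : dist (y + t • e) y = t := by
      rw [dist_eq_norm, add_sub_cancel_left, norm_smul, h.norm_eq, mul_one,
        Real.norm_of_nonneg ht.1.le]
    have h2 := dist_triangle (y + t • e) y x
    rw [Metric.mem_ball] at hyx ⊢
    linarith [ht.2]
  rw [h.mem_iff _ hmem, map_add, map_smul, orthogonalProjectionOnto_self, smul_zero, add_zero,
    ← h.inner_eq hΩ hy (hb hyx), inner_add_right, inner_smul_right, real_inner_self_eq_norm_sq,
    h.norm_eq]
  linarith [ht.1]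

/-- Near a boundary point, surface measure is controlled by the Lebesgue measure of the hyperplane
over which the boundary is a graph. -/
lemma IsGraphPatch.surfaceMeasure_le (h : IsGraphPatch Ω x δ e K g) (hn : 1 ≤ n) (hΩ : IsOpen Ω) :
    (surfaceMeasure Ω).restrict (Metric.ball x δ) ≤
      ((1 + K) ^ (n - 1) : ℝ≥0) • Measure.map (graphMap e g) volume := by
  have hG : Measurable (graphMap e g) :=
    (lipschitzWith_graphMap h.norm_eq h.lipschitz).continuous.measurable
  refine Measure.le_iff.2 fun s hs => ?_
  rw [surfaceMeasure, Measure.restrict_apply hs,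
    Measure.restrict_apply (hs.inter Metric.isOpen_ball.measurableSet), Measure.smul_apply,
    Measure.map_apply hG hs]
  refine (euclideanHausdorffMeasure_graph_le hn h.norm_eq h.lipschitz fun y hy =>
    h.inner_eq hΩ hy.2 (Metric.ball_subset_ball (by linarith [h.pos]) hy.1.2)).trans ?_
  rw [ENNReal.smul_def, smul_eq_mul]
  push_cast
  gcongr
  exact fun y hy => hy.1.1

lemma IsGraphPatch.surfaceMeasure_ball_le (h : IsGraphPatch Ω x δ e K g) (hn : 1 ≤ n)
    (hΩ : IsOpen Ω) : ∃ c : ℝ≥0, ∀ (y : E n) (r : ℝ), 0 < r →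
      surfaceMeasure Ω (Metric.ball x δ ∩ Metric.ball y r) ≤ c * ENNReal.ofReal r ^ (n - 1) := by
  have hfin : Fact (Module.finrank ℝ (E n) = (n - 1) + 1) := ⟨by simp; omega⟩
  have hH : Module.finrank ℝ (ℝ ∙ e)ᗮ = n - 1 :=
    Submodule.finrank_orthogonal_span_singleton (by rintro rfl; simpa using h.norm_eq)
  have hG : Measurable (graphMap e g) :=
    (lipschitzWith_graphMap h.norm_eq h.lipschitz).continuous.measurable
  have hv : volume (Metric.ball (0 : (ℝ ∙ e)ᗮ) 1) ≠ ⊤ := measure_ball_lt_top.ne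
  obtain ⟨v, hv⟩ : ∃ v : ℝ≥0, (v : ℝ≥0∞) = volume (Metric.ball (0 : (ℝ ∙ e)ᗮ) 1) :=
    ⟨_, ENNReal.coe_toNNReal hv⟩
  refine ⟨(1 + K) ^ (n - 1) * v, fun y r hr => ?_⟩
  have h1 := h.surfaceMeasure_le hn hΩ (Metric.ball y r)
  rw [Measure.restrict_apply Metric.isOpen_ball.measurableSet, Set.inter_comm, Measure.smul_apply,
    Measure.map_apply hG Metric.isOpen_ball.measurableSet, ENNReal.smul_def, smul_eq_mul] at h1
  refine h1.trans ?_
  have h2 : graphMap e g ⁻¹' Metric.ball y r ⊆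
      Metric.ball ((ℝ ∙ e)ᗮ.orthogonalProjectionOnto y) r := by
    intro z hz
    have hz : dist (graphMap e g z) y < r := hz
    rw [Metric.mem_ball]
    calc dist z _ = dist ((ℝ ∙ e)ᗮ.orthogonalProjectionOnto (graphMap e g z))
          ((ℝ ∙ e)ᗮ.orthogonalProjectionOnto y) := by
          rw [graphMap, orthogonalProjectionOnto_add_smul]
      _ ≤ dist (graphMap e g z) y := by
          simpa using (Submodule.lipschitzWith_orthogonalProjectionOnto (K := (ℝ ∙ e)ᗮ)).dist_le_mul
            (graphMap e g z) y
      _ < r := hz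
  have h3 := Measure.addHaar_ball_of_pos (volume : Measure (ℝ ∙ e)ᗮ)
    ((ℝ ∙ e)ᗮ.orthogonalProjectionOnto y) hr
  rw [hH, ← hv, ENNReal.ofReal_pow hr.le] at h3
  push_cast
  rw [mul_assoc]
  gcongr
  calc _ ≤ _ := measure_mono h2
    _ = _ := by rw [h3, mul_comm]

/-- Integration over a collar: integrals along segments of length `δ` that start on the boundary and
point in the direction `e` are controlled by integrals over the domain. -/
lemma IsGraphPatch.lintegral_collar_le (h : IsGraphPatch Ω x δ e K g) (hn : 1 ≤ n)
    (hΩ : IsOpen Ω) : ∃ c : ℝ≥0, ∀ f : E n → ℝ≥0∞, Measurable f →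
      ∫⁻ y in Metric.ball x δ, (∫⁻ t in Set.Ioo 0 δ, f (y + t • e)) ∂(surfaceMeasure Ω) ≤
        c * ∫⁻ y in Ω, f y := by
  obtain ⟨c, hc⟩ := exists_lintegral_orthogonal_le h.norm_eq
  refine ⟨(1 + K) ^ (n - 1) * c, fun f hf => ?_⟩
  have hG : Measurable (graphMap e g) :=
    (lipschitzWith_graphMap h.norm_eq h.lipschitz).continuous.measurable
  have hF : Measurable (Ω.indicator f) := hf.indicator hΩ.measurableSet
  have hmeas : Measurable fun y : E n => ∫⁻ t in Set.Ioo 0 δ, Ω.indicator f (y + t • e) := by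
    refine Measurable.lintegral_prod_right' (f := fun q : E n × ℝ => Ω.indicator f (q.1 + q.2 • e))
      (hF.comp ?_)
    fun_prop
  calc ∫⁻ y in Metric.ball x δ, (∫⁻ t in Set.Ioo 0 δ, f (y + t • e)) ∂(surfaceMeasure Ω)
      ≤ ∫⁻ y in Metric.ball x δ, (∫⁻ t in Set.Ioo 0 δ, Ω.indicator f (y + t • e))
          ∂(surfaceMeasure Ω) := by
        have hfr : ∀ᵐ y ∂(surfaceMeasure Ω).restrict (Metric.ball x δ),
            y ∈ frontier Ω ∧ y ∈ Metric.ball x δ := by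
          rw [surfaceMeasure]
          filter_upwards [ae_restrict_mem Metric.isOpen_ball.measurableSet,
            ae_restrict_of_ae (ae_restrict_mem isClosed_frontier.measurableSet)] with y h1 h2
          exact ⟨h2, h1⟩
        refine lintegral_mono_ae ?_
        filter_upwards [hfr] with y hy
        refine setLIntegral_mono' measurableSet_Ioo fun t ht => ?_
        rw [Set.indicator_of_mem (h.add_smul_mem hΩ hy.1 hy.2 ht)]
    _ ≤ ∫⁻ y, (∫⁻ t in Set.Ioo 0 δ, Ω.indicator f (y + t • e))
          ∂(((1 + K) ^ (n - 1) : ℝ≥0) • Measure.map (graphMap e g) volume) :=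
        lintegral_mono' (h.surfaceMeasure_le hn hΩ) le_rfl
    _ = ((1 + K) ^ (n - 1) : ℝ≥0) *
          ∫⁻ z, ∫⁻ t in Set.Ioo 0 δ, Ω.indicator f (graphMap e g z + t • e) := by
        rw [lintegral_smul_measure, lintegral_map hmeas hG]
        rfl
    _ ≤ ((1 + K) ^ (n - 1) : ℝ≥0) *
          ∫⁻ z : (ℝ ∙ e)ᗮ, ∫⁻ t : ℝ, Ω.indicator f ((z : E n) + t • e) := by
        refine mul_le_mul_right (lintegral_mono fun z => ?_) _
        refine (setLIntegral_le_lintegral _ _).trans (le_of_eq ?_)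
        rw [← lintegral_add_left_eq_self (fun t : ℝ => Ω.indicator f ((z : E n) + t • e)) (g z)]
        refine lintegral_congr fun t => ?_
        rw [graphMap, add_smul, add_assoc]
    _ ≤ ((1 + K) ^ (n - 1) : ℝ≥0) * (c * ∫⁻ y, Ω.indicator f y) := by
        gcongr
        exact hc _ hF
    _ = _ := by
        rw [lintegral_indicator hΩ.measurableSet]
        push_cast
        rw [mul_assoc]

end Patch

section Finiteness

variable {n : ℕ} {Ω : Set (E n)}

lemma IsBoundedLipschitzDomain.isCompact_frontier (hΩ : IsBoundedLipschitzDomain Ω) :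
    IsCompact (frontier Ω) :=
  Metric.isCompact_of_isClosed_isBounded isClosed_frontier
    (hΩ.isBounded.closure.subset frontier_subset_closure)

lemma surfaceMeasure_eq_frontier_inter (s : Set (E n)) :
    surfaceMeasure Ω s = surfaceMeasure Ω (frontier Ω ∩ s) := by
  rw [surfaceMeasure, Measure.restrict_apply' isClosed_frontier.measurableSet,
    Measure.restrict_apply' isClosed_frontier.measurableSet]
  congr 1
  ext y
  simp only [Set.mem_inter_iff]
  tauto

/-- The surface measure of a ball of radius `r` is at most a multiple of `r ^ (n - 1)`. -/
lemma IsBoundedLipschitzDomain.exists_surfaceMeasure_ball_le (hΩ : IsBoundedLipschitzDomain Ω)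
    (hn : 1 ≤ n) : ∃ c : ℝ≥0, ∀ (y : E n) (r : ℝ), 0 < r →
      surfaceMeasure Ω (Metric.ball y r) ≤ c * ENNReal.ofReal r ^ (n - 1) := by
  have h : ∀ x : frontier Ω, ∃ δ > 0, ∃ c : ℝ≥0, ∀ (y : E n) (r : ℝ), 0 < r →
      surfaceMeasure Ω (Metric.ball (x : E n) δ ∩ Metric.ball y r) ≤
        c * ENNReal.ofReal r ^ (n - 1) := by
    intro x
    obtain ⟨δ, e, K, g, hp⟩ := hΩ.lipschitz.exists_patch x.2
    exact ⟨δ, hp.pos, hp.surfaceMeasure_ball_le hn hΩ.isOpen⟩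
  choose δ hδ c hc using h
  obtain ⟨t, ht⟩ := hΩ.isCompact_frontier.elim_finite_subcover
    (fun x : frontier Ω => Metric.ball (x : E n) (δ x)) (fun _ => Metric.isOpen_ball)
    (fun x hx => Set.mem_iUnion.2 ⟨⟨x, hx⟩, Metric.mem_ball_self (hδ _)⟩)
  refine ⟨∑ x ∈ t, c x, fun y r hr => ?_⟩
  rw [surfaceMeasure_eq_frontier_inter]
  calc _ ≤ surfaceMeasure Ω (⋃ x ∈ t, Metric.ball (x : E n) (δ x) ∩ Metric.ball y r) := by
        refine measure_mono fun z hz => ?_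
        obtain ⟨x, hx, hzx⟩ := Set.mem_iUnion₂.1 (ht hz.1)
        exact Set.mem_iUnion₂.2 ⟨x, hx, hzx, hz.2⟩
    _ ≤ ∑ x ∈ t, surfaceMeasure Ω (Metric.ball (x : E n) (δ x) ∩ Metric.ball y r) :=
        measure_biUnion_finset_le _ _
    _ ≤ ∑ x ∈ t, c x * ENNReal.ofReal r ^ (n - 1) := Finset.sum_le_sum fun x _ => hc x y r hr
    _ = _ := by rw [← Finset.sum_mul]; push_cast; rfl

lemma IsBoundedLipschitzDomain.exists_ball (hΩ : IsBoundedLipschitzDomain Ω) :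
    ∃ R : ℝ, 0 < R ∧ frontier Ω ⊆ Metric.ball 0 R := by
  obtain ⟨R, hR, h⟩ := hΩ.isCompact_frontier.isBounded.subset_ball_lt 0 0
  exact ⟨R, hR, h⟩

lemma IsBoundedLipschitzDomain.isFiniteMeasure (hΩ : IsBoundedLipschitzDomain Ω) (hn : 1 ≤ n) :
    IsFiniteMeasure (surfaceMeasure Ω) := by
  obtain ⟨c, hc⟩ := hΩ.exists_surfaceMeasure_ball_le hn
  obtain ⟨R, hR, hsub⟩ := hΩ.exists_ball
  refine ⟨?_⟩
  rw [surfaceMeasure_eq_frontier_inter, Set.inter_univ]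
  refine (measure_mono hsub).trans_lt ((hc 0 R hR).trans_lt ?_)
  exact ENNReal.mul_lt_top ENNReal.coe_lt_top (ENNReal.pow_lt_top ENNReal.ofReal_lt_top)

lemma unitBallVolume_pos (m : ℕ) : 0 < unitBallVolume m :=
  Metric.measure_ball_pos _ _ one_pos

lemma unitBallVolume_ne_top (m : ℕ) : unitBallVolume m ≠ ⊤ := measure_ball_lt_top.ne

lemma IsBoundedLipschitzDomain.distortion_ne_top (hΩ : IsBoundedLipschitzDomain Ω) (hn : 1 ≤ n) :
    distortion Ω ≠ ⊤ := by
  obtain ⟨c, hc⟩ := hΩ.exists_surfaceMeasure_ball_le hn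
  refine ne_top_of_le_ne_top (b := c / unitBallVolume (n - 1))
    (ENNReal.div_ne_top ENNReal.coe_ne_top (unitBallVolume_pos _).ne') ?_
  refine iSup_le fun y => iSup_le fun r => iSup_le fun hr => ?_
  rw [← surfaceMeasure_eq_frontier_inter]
  refine ENNReal.div_le_of_le_mul ((hc y r hr).trans (le_of_eq ?_))
  rw [← mul_assoc, ENNReal.div_mul_cancel (unitBallVolume_pos _).ne' (unitBallVolume_ne_top _)]

lemma surfaceMeasure_ball_le_distortion (y : E n) {r : ℝ} (hr : 0 < r) :
    surfaceMeasure Ω (Metric.ball y r) ≤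
      distortion Ω * (unitBallVolume (n - 1) * ENNReal.ofReal r ^ (n - 1)) := by
  have h : surfaceMeasure Ω (frontier Ω ∩ Metric.ball y r) /
      (unitBallVolume (n - 1) * ENNReal.ofReal r ^ (n - 1)) ≤ distortion Ω :=
    le_iSup_of_le y (le_iSup_of_le r (le_iSup_of_le hr le_rfl))
  rw [surfaceMeasure_eq_frontier_inter]
  refine (ENNReal.div_le_iff_le_mul (Or.inl ?_) (Or.inl ?_)).1 h
  · exact mul_ne_zero (unitBallVolume_pos _).ne' (pow_ne_zero _ (by simpa using hr))
  · exact ENNReal.mul_ne_top (unitBallVolume_ne_top _) (ENNReal.pow_ne_top ENNReal.ofReal_ne_top)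

end Finiteness

/-! ### Traces of smooth functions -/

variable {n : ℕ} {Ω : Set (E n)}

lemma enorm_gradient (φ : E n → ℝ) (x : E n) : ‖gradient φ x‖ₑ = ‖fderiv ℝ φ x‖ₑ := by
  rw [← ofReal_norm, ← ofReal_norm, gradient, LinearIsometryEquiv.norm_map]

lemma continuous_gradient {φ : E n → ℝ} (hφ : ContDiff ℝ ∞ φ) : Continuous (gradient φ) :=
  (InnerProductSpace.toDual ℝ (E n)).symm.continuous.comp (hφ.continuous_fderiv (by simp))

lemma inner_gradient (φ : E n → ℝ) (x e : E n) : inner ℝ (gradient φ x) e = fderiv ℝ φ x e := by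
  rw [gradient, InnerProductSpace.toDual_symm_apply]

/-- The fundamental theorem of calculus along a segment, averaged over its end point. -/
lemma mul_enorm_le_lintegral_segment {ψ : E n → ℝ} (hψ : ContDiff ℝ ∞ ψ) {δ : ℝ}
    {e : E n} (he : ‖e‖ = 1) (y : E n) :
    ENNReal.ofReal δ * ‖ψ y‖ₑ ≤ ∫⁻ t in Set.Ioo 0 δ,
      (‖ψ (y + t • e)‖ₑ + ENNReal.ofReal δ * ‖gradient ψ (y + t • e)‖ₑ) := by
  have hline : Continuous fun t : ℝ => y + t • e := by fun_prop
  have hcg : Continuous fun t : ℝ => gradient ψ (y + t • e) := (continuous_gradient hψ).comp hline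
  have hcψ : Continuous fun t : ℝ => ψ (y + t • e) := hψ.continuous.comp hline
  set I := ∫⁻ t in Set.Ioo 0 δ, ‖gradient ψ (y + t • e)‖ₑ with hI
  have hpt : ∀ t ∈ Set.Ioo 0 δ, ‖ψ y‖ₑ ≤ ‖ψ (y + t • e)‖ₑ + I := by
    intro t ht
    have hd : ∀ s : ℝ, HasDerivAt (fun s : ℝ => ψ (y + s • e))
        (inner ℝ (gradient ψ (y + s • e)) e) s := by
      intro s
      have h1 : HasDerivAt (fun s : ℝ => y + s • e) e s := by
        simpa using ((hasDerivAt_id s).smul_const e).const_add y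
      rw [inner_gradient]
      exact ((hψ.differentiable (by simp) _).hasFDerivAt).comp_hasDerivAt s h1
    have hcd : Continuous fun s : ℝ => inner ℝ (gradient ψ (y + s • e)) e :=
      hcg.inner continuous_const
    have hftc := intervalIntegral.integral_eq_sub_of_hasDerivAt (a := 0) (b := t)
      (fun s _ => hd s) (hcd.intervalIntegrable _ _)
    rw [zero_smul, add_zero] at hftc
    have hval : ψ y = ψ (y + t • e) - ∫ s in (0 : ℝ)..t, inner ℝ (gradient ψ (y + s • e)) e := by
      rw [hftc]; ring
    have hint : ‖∫ s in (0 : ℝ)..t, inner ℝ (gradient ψ (y + s • e)) e‖ₑ ≤ I := by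
      rw [intervalIntegral.integral_of_le ht.1.le]
      refine (enorm_integral_le_lintegral_enorm _).trans ?_
      calc _ ≤ ∫⁻ s in Set.Ioc 0 t, ‖gradient ψ (y + s • e)‖ₑ := by
            refine lintegral_mono fun s => ?_
            rw [← ofReal_norm, ← ofReal_norm]
            refine ENNReal.ofReal_le_ofReal ((norm_inner_le_norm _ _).trans ?_)
            rw [he, mul_one]
        _ ≤ I := lintegral_mono_set fun s hs => ⟨hs.1, hs.2.trans_lt ht.2⟩
    calc ‖ψ y‖ₑ = ‖ψ (y + t • e) - ∫ s in (0 : ℝ)..t, inner ℝ (gradient ψ (y + s • e)) e‖ₑ := by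
          rw [← hval]
      _ ≤ _ := enorm_sub_le
      _ ≤ _ := by gcongr
  have hvol : (volume.restrict (Set.Ioo 0 δ)) Set.univ = ENNReal.ofReal δ := by simp
  calc ENNReal.ofReal δ * ‖ψ y‖ₑ = ∫⁻ _ in Set.Ioo 0 δ, ‖ψ y‖ₑ := by
        rw [lintegral_const, hvol, mul_comm]
    _ ≤ ∫⁻ t in Set.Ioo 0 δ, (‖ψ (y + t • e)‖ₑ + I) := setLIntegral_mono' measurableSet_Ioo hpt
    _ = (∫⁻ t in Set.Ioo 0 δ, ‖ψ (y + t • e)‖ₑ) + ENNReal.ofReal δ * I := by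
        rw [lintegral_add_right _ measurable_const, lintegral_const, hvol, mul_comm I]
    _ = _ := by
        rw [hI, ← lintegral_const_mul _ hcg.enorm.measurable,
          lintegral_add_left hcψ.enorm.measurable]

/-- A local trace inequality in `L¹`. -/
lemma IsGraphPatch.eLpNorm_le {x : E n} {δ : ℝ} {e : E n} {K : ℝ≥0} {g : (ℝ ∙ e)ᗮ → ℝ}
    (h : IsGraphPatch Ω x δ e K g) (hn : 1 ≤ n) (hΩ : IsOpen Ω) : ∃ c : ℝ≥0, ∀ ψ : E n → ℝ,
      ContDiff ℝ ∞ ψ → eLpNorm ψ 1 ((surfaceMeasure Ω).restrict (Metric.ball x δ)) ≤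
        c * (eLpNorm ψ 1 (volume.restrict Ω) + eLpNorm (gradient ψ) 1 (volume.restrict Ω)) := by
  obtain ⟨c, hc⟩ := h.lintegral_collar_le hn hΩ
  refine ⟨δ.toNNReal⁻¹ * c * (1 + δ.toNNReal), fun ψ hψ => ?_⟩
  have hδ : (δ.toNNReal : ℝ≥0∞) ≠ 0 := by simpa using h.pos
  have hcg := continuous_gradient hψ
  have hm : Measurable fun y => ‖ψ y‖ₑ + ENNReal.ofReal δ * ‖gradient ψ y‖ₑ :=
    hψ.continuous.enorm.measurable.add (hcg.enorm.measurable.const_mul _)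
  simp only [eLpNorm_one_eq_lintegral_enorm]
  set a := ∫⁻ y in Ω, ‖ψ y‖ₑ with ha
  set b := ∫⁻ y in Ω, ‖gradient ψ y‖ₑ with hb
  have h1 : (δ.toNNReal : ℝ≥0∞) * ∫⁻ y in Metric.ball x δ, ‖ψ y‖ₑ ∂surfaceMeasure Ω ≤
      c * (a + δ.toNNReal * b) := by
    rw [← lintegral_const_mul _ hψ.continuous.enorm.measurable]
    refine (lintegral_mono fun y => mul_enorm_le_lintegral_segment hψ h.norm_eq y).trans ?_
    refine (hc _ hm).trans (le_of_eq ?_)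
    rw [lintegral_add_left hψ.continuous.enorm.measurable,
      lintegral_const_mul _ hcg.enorm.measurable]
    rfl
  rw [mul_comm, ← ENNReal.le_div_iff_mul_le (Or.inl hδ) (Or.inl ENNReal.coe_ne_top)] at h1
  refine h1.trans ?_
  rw [ENNReal.div_eq_inv_mul]
  push_cast
  rw [ENNReal.coe_inv (by simpa using h.pos), mul_assoc, mul_assoc]
  gcongr
  calc a + δ.toNNReal * b ≤ (1 + δ.toNNReal) * a + (1 + δ.toNNReal) * b := by
        gcongr
        · exact le_mul_of_one_le_left' le_self_add
        · exact le_add_self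
    _ = _ := by ring

/-- Traces are unique: a boundary trace of the Sobolev function given by a smooth function is its
restriction to the boundary. -/
lemma IsTrace.ae_eq {p : ℝ} (hp : 1 < p) (hn : 1 ≤ n) (hΩ : IsBoundedLipschitzDomain Ω)
    {w : LpPair p Ω} {g : Lp ℝ (ENNReal.ofReal p) (surfaceMeasure Ω)} (hg : IsTrace w g)
    {φ : E n → ℝ} (hφ : ContDiff ℝ ∞ φ) (h1 : w.1 =ᵐ[volume.restrict Ω] φ)
    (h2 : w.2 =ᵐ[volume.restrict Ω] gradient φ) : g =ᵐ[surfaceMeasure Ω] φ := by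
  obtain ⟨φs, hφs, ht1, ht2, ht3⟩ := hg
  have hfin := hΩ.isFiniteMeasure hn
  have hvol : IsFiniteMeasure (volume.restrict Ω) :=
    ⟨by rw [Measure.restrict_apply_univ]; exact hΩ.isBounded.measure_lt_top⟩
  have hp1 : (1 : ℝ≥0∞) ≤ ENNReal.ofReal p := by
    rw [← ENNReal.ofReal_one]; exact ENNReal.ofReal_le_ofReal hp.le
  have hexp : 0 ≤ 1 / (1 : ℝ≥0∞).toReal - 1 / (ENNReal.ofReal p).toReal := by
    rw [ENNReal.toReal_ofReal (by linarith), ENNReal.toReal_one]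
    have : 1 / p ≤ 1 := (div_le_one₀ (by linarith)).2 hp.le
    linarith
  -- convergence in `Lᵖ` for a finite measure gives convergence in `L¹`
  have hL1 : ∀ {F : Type} [NormedAddCommGroup F] (μ : Measure (E n)) [IsFiniteMeasure μ]
      (f : ℕ → E n → F), (∀ j, AEStronglyMeasurable (f j) μ) →
      Tendsto (fun j => eLpNorm (f j) (ENNReal.ofReal p) μ) atTop (𝓝 0) →
      Tendsto (fun j => eLpNorm (f j) 1 μ) atTop (𝓝 0) := by
    intro F _ μ _ f hf hlim
    have h := ENNReal.Tendsto.mul_const hlim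
      (b := μ Set.univ ^ (1 / (1 : ℝ≥0∞).toReal - 1 / (ENNReal.ofReal p).toReal))
      (Or.inr (ENNReal.rpow_ne_top_of_nonneg hexp (measure_ne_top _ _)))
    rw [zero_mul] at h
    exact tendsto_of_tendsto_of_tendsto_of_le_of_le tendsto_const_nhds h (fun _ => zero_le)
      fun j => eLpNorm_le_eLpNorm_mul_rpow_measure_univ hp1 (hf j)
  have hgrad : ∀ j, gradient (fun y => φs j y - φ y) =
      fun y => gradient (φs j) y - gradient φ y := by
    intro j
    funext y
    rw [gradient, gradient, gradient, ← map_sub]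
    congr 1
    exact fderiv_fun_sub ((hφs j).1.differentiable (by simp) y) (hφ.differentiable (by simp) y)
  have hsm : ∀ j, ContDiff ℝ ∞ fun y => φs j y - φ y := fun j => (hφs j).1.sub hφ
  have hd1 : Tendsto (fun j => eLpNorm (fun y => φs j y - φ y) 1 (volume.restrict Ω))
      atTop (𝓝 0) := by
    refine hL1 _ _ (fun j => (hsm j).continuous.aestronglyMeasurable) (ht1.congr fun j => ?_)
    refine eLpNorm_congr_ae ?_
    filter_upwards [h1] with y hy
    rw [hy]
  have hd2 : Tendsto (fun j => eLpNorm (gradient fun y => φs j y - φ y) 1 (volume.restrict Ω))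
      atTop (𝓝 0) := by
    refine hL1 _ _ (fun j => (continuous_gradient (hsm j)).aestronglyMeasurable)
      (ht2.congr fun j => ?_)
    refine eLpNorm_congr_ae ?_
    filter_upwards [h2] with y hy
    rw [hy, hgrad]
  have hd3 : Tendsto (fun j => eLpNorm (fun y => φs j y - g y) 1 (surfaceMeasure Ω))
      atTop (𝓝 0) :=
    hL1 _ _ (fun j => (hφs j).1.continuous.aestronglyMeasurable.sub
      (Lp.aestronglyMeasurable g)) ht3
  -- the two limits agree near each boundary point
  have hloc : ∀ x ∈ frontier Ω, ∃ δ > 0,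
      surfaceMeasure Ω ({y | g y ≠ φ y} ∩ Metric.ball x δ) = 0 := by
    intro x hx
    obtain ⟨δ, e, K, γ, hpatch⟩ := hΩ.lipschitz.exists_patch hx
    obtain ⟨c, hc⟩ := hpatch.eLpNorm_le hn hΩ.isOpen
    refine ⟨δ, hpatch.pos, ?_⟩
    set μ := (surfaceMeasure Ω).restrict (Metric.ball x δ) with hμ
    have hb1 : Tendsto (fun j => eLpNorm (fun y => φs j y - φ y) 1 μ) atTop (𝓝 0) := by
      have h := ENNReal.Tendsto.const_mul (hd1.add hd2) (a := (c : ℝ≥0∞))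
        (Or.inr ENNReal.coe_ne_top)
      rw [add_zero, mul_zero] at h
      exact tendsto_of_tendsto_of_tendsto_of_le_of_le tendsto_const_nhds h (fun _ => zero_le)
        fun j => hc _ (hsm j)
    have hb2 : Tendsto (fun j => eLpNorm (fun y => φs j y - g y) 1 μ) atTop (𝓝 0) :=
      tendsto_of_tendsto_of_tendsto_of_le_of_le tendsto_const_nhds hd3 (fun _ => zero_le)
        fun j => eLpNorm_mono_measure _ Measure.restrict_le_self
    have hgm : AEStronglyMeasurable (fun y => g y) μ :=
      (Lp.aestronglyMeasurable g).mono_measure Measure.restrict_le_self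
    have hle : eLpNorm (fun y => g y - φ y) 1 μ ≤ 0 := by
      have hsum := hb1.add hb2
      rw [add_zero] at hsum
      refine ge_of_tendsto' hsum fun j => ?_
      have hrw : (fun y => g y - φ y) = fun y => (φs j y - φ y) - (φs j y - g y) := by
        funext y; ring
      rw [hrw]
      exact eLpNorm_sub_le ((hsm j).continuous.aestronglyMeasurable)
        ((hφs j).1.continuous.aestronglyMeasurable.sub hgm) le_rfl
    have hzero := (eLpNorm_eq_zero_iff (hgm.sub hφ.continuous.aestronglyMeasurable)
      one_ne_zero).1 (le_antisymm hle zero_le)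
    have h0 : μ {y | g y ≠ φ y} = 0 := by
      rw [← nonpos_iff_eq_zero]
      refine le_of_le_of_eq (measure_mono fun y hy => ?_) hzero
      exact fun h => hy (sub_eq_zero.1 h)
    rwa [hμ, Measure.restrict_apply' Metric.isOpen_ball.measurableSet] at h0
  show surfaceMeasure Ω {y | g y ≠ φ y} = 0
  rw [surfaceMeasure_eq_frontier_inter]
  refine measure_null_of_locally_null _ fun x hx => ?_
  obtain ⟨δ, hδ, h0⟩ := hloc x hx.1
  refine ⟨({y | g y ≠ φ y} ∩ Metric.ball x δ), ?_, h0⟩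
  exact mem_nhdsWithin.2 ⟨Metric.ball x δ, Metric.isOpen_ball, Metric.mem_ball_self hδ,
    fun y hy => ⟨hy.2.2, hy.1⟩⟩

/-! ### The Sobolev functions given by smooth functions -/

/-- The space `C_c^∞(ℝⁿ)`. -/
def testSpace (n : ℕ) : Submodule ℝ (E n → ℝ) where
  carrier := {φ | ContDiff ℝ ∞ φ ∧ HasCompactSupport φ}
  add_mem' h1 h2 := ⟨h1.1.add h2.1, h1.2.add h2.2⟩
  zero_mem' := ⟨contDiff_const, HasCompactSupport.zero⟩
  smul_mem' _ _ h := ⟨contDiff_const.smul h.1, h.2.smul_left⟩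

lemma hasCompactSupport_gradient {φ : E n → ℝ} (hφ : HasCompactSupport φ) :
    HasCompactSupport (gradient φ) :=
  (hφ.fderiv ℝ).comp_left (map_zero _)

lemma gradient_add' (φ ψ : testSpace n) :
    gradient (φ + ψ : E n → ℝ) = gradient (φ : E n → ℝ) + gradient (ψ : E n → ℝ) := by
  funext y
  rw [Pi.add_apply, gradient, gradient, gradient, ← map_add]
  congr 1
  exact fderiv_add (φ.2.1.differentiable (by simp) y) (ψ.2.1.differentiable (by simp) y)

lemma gradient_smul' (c : ℝ) (φ : testSpace n) :
    gradient (c • φ : E n → ℝ) = c • gradient (φ : E n → ℝ) := by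
  funext y
  rw [Pi.smul_apply, gradient, gradient, ← map_smul]
  congr 1
  exact fderiv_const_smul (φ.2.1.differentiable (by simp) y) c

section Classes

variable {p : ℝ}

lemma memLp_testSpace (φ : testSpace n) (q : ℝ≥0∞) (μ : Measure (E n))
    [IsFiniteMeasureOnCompacts μ] : MemLp (φ : E n → ℝ) q μ :=
  φ.2.1.continuous.memLp_of_hasCompactSupport φ.2.2

lemma memLp_gradient_testSpace (φ : testSpace n) (q : ℝ≥0∞) (μ : Measure (E n))
    [IsFiniteMeasureOnCompacts μ] : MemLp (gradient (φ : E n → ℝ)) q μ :=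
  (continuous_gradient φ.2.1).memLp_of_hasCompactSupport (hasCompactSupport_gradient φ.2.2)

variable (p Ω)

/-- The element `(φ, ∇φ)` of `W^{1,p}(Ω)` given by a smooth function `φ`. -/
def toSobolev : testSpace n →ₗ[ℝ] LpPair p Ω where
  toFun φ := ((memLp_testSpace φ _ _).toLp _, (memLp_gradient_testSpace φ _ _).toLp _)
  map_add' φ ψ := by
    refine Prod.ext (MemLp.toLp_add (memLp_testSpace φ _ _) (memLp_testSpace ψ _ _)) ?_
    rw [Prod.snd_add, ← MemLp.toLp_add]
    exact MemLp.toLp_congr (memLp_gradient_testSpace (φ + ψ) _ _) _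
      (by rw [← gradient_add']; rfl)
  map_smul' c φ := by
    refine Prod.ext (MemLp.toLp_const_smul c (memLp_testSpace φ _ _)) ?_
    rw [Prod.smul_snd, RingHom.id_apply, ← MemLp.toLp_const_smul]
    exact MemLp.toLp_congr (memLp_gradient_testSpace (c • φ) _ _) _
      (by rw [← gradient_smul']; rfl)

lemma toSobolev_fst (φ : testSpace n) : (toSobolev Ω p φ).1 =ᵐ[volume.restrict Ω] φ :=
  MemLp.coeFn_toLp (memLp_testSpace φ _ _)

lemma toSobolev_snd (φ : testSpace n) :
    (toSobolev Ω p φ).2 =ᵐ[volume.restrict Ω] gradient (φ : E n → ℝ) :=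
  MemLp.coeFn_toLp (memLp_gradient_testSpace φ _ _)

lemma toSobolev_mem_W1p (φ : testSpace n) : toSobolev Ω p φ ∈ W1p p Ω := by
  intro η hη hηc hηs e
  have e1 : ∫ x in Ω, (toSobolev Ω p φ).1 x * fderiv ℝ η x e =
      ∫ x in Ω, (φ : E n → ℝ) x * fderiv ℝ η x e := by
    refine integral_congr_ae ?_
    filter_upwards [toSobolev_fst Ω p φ] with x hx
    rw [hx]
  have e2 : ∫ x in Ω, inner ℝ ((toSobolev Ω p φ).2 x) e * η x =
      ∫ x in Ω, fderiv ℝ (φ : E n → ℝ) x e * η x := by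
    refine integral_congr_ae ?_
    filter_upwards [toSobolev_snd Ω p φ] with x hx
    rw [hx, inner_gradient]
  have hη0 : ∀ x, x ∉ Ω → η x = 0 := fun x hx =>
    image_eq_zero_of_notMem_tsupport fun h => hx (hηs h)
  have hdη0 : ∀ x, x ∉ Ω → fderiv ℝ η x = 0 := fun x hx =>
    image_eq_zero_of_notMem_tsupport fun h => hx (hηs (tsupport_fderiv_subset ℝ h))
  have hdη : Continuous fun x => fderiv ℝ η x e :=
    (hη.continuous_fderiv (by simp)).clm_apply continuous_const
  have hdφ : Continuous fun x => fderiv ℝ (φ : E n → ℝ) x e :=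
    (φ.2.1.continuous_fderiv (by simp)).clm_apply continuous_const
  rw [e1, e2, setIntegral_eq_integral_of_forall_compl_eq_zero fun x hx => by simp [hdη0 x hx],
    setIntegral_eq_integral_of_forall_compl_eq_zero fun x hx => by simp [hη0 x hx]]
  refine integral_mul_fderiv_eq_neg_fderiv_mul_of_integrable ?_ ?_ ?_
    (fun x _ => φ.2.1.differentiable (by simp) x) (fun x _ => hη.differentiable (by simp) x)
  · exact (hdφ.mul hη.continuous).integrable_of_hasCompactSupport hηc.mul_left
  · exact (φ.2.1.continuous.mul hdη).integrable_of_hasCompactSupport φ.2.2.mul_right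
  · exact (φ.2.1.continuous.mul hη.continuous).integrable_of_hasCompactSupport hηc.mul_left

/-- The boundary values of smooth functions. -/
def boundaryValues [IsFiniteMeasure (surfaceMeasure Ω)] :
    testSpace n →ₗ[ℝ] Lp ℝ (ENNReal.ofReal p) (surfaceMeasure Ω) where
  toFun φ := (memLp_testSpace φ _ _).toLp _
  map_add' φ ψ := MemLp.toLp_add (memLp_testSpace φ _ _) (memLp_testSpace ψ _ _)
  map_smul' c φ := MemLp.toLp_const_smul c (memLp_testSpace φ _ _)

lemma coeFn_boundaryValues [IsFiniteMeasure (surfaceMeasure Ω)] (φ : testSpace n) :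
    boundaryValues Ω p φ =ᵐ[surfaceMeasure Ω] φ :=
  MemLp.coeFn_toLp (memLp_testSpace φ _ _)

variable {p Ω}

lemma trace_toSobolev (hp : 1 < p) (hn : 1 ≤ n) (hΩ : IsBoundedLipschitzDomain Ω)
    [IsFiniteMeasure (surfaceMeasure Ω)] (φ : testSpace n) :
    trace (toSobolev Ω p φ) = boundaryValues Ω p φ := by
  have hval := coeFn_boundaryValues Ω p φ
  have hex : ∃ g, IsTrace (toSobolev Ω p φ) g := by
    refine ⟨boundaryValues Ω p φ, fun _ => φ, fun _ => φ.2, ?_, ?_, ?_⟩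
    · refine tendsto_const_nhds.congr fun _ => Eq.symm ?_
      rw [eLpNorm_congr_ae (g := fun _ => (0 : ℝ)), eLpNorm_zero']
      filter_upwards [toSobolev_fst Ω p φ] with x hx
      rw [hx, sub_self]
    · refine tendsto_const_nhds.congr fun _ => Eq.symm ?_
      rw [eLpNorm_congr_ae (g := fun _ => (0 : E n)), eLpNorm_zero']
      filter_upwards [toSobolev_snd Ω p φ] with x hx
      rw [hx, sub_self]
    · refine tendsto_const_nhds.congr fun _ => Eq.symm ?_
      rw [eLpNorm_congr_ae (g := fun _ => (0 : ℝ)), eLpNorm_zero']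
      filter_upwards [hval] with x hx
      rw [hx, sub_self]
  rw [trace, dif_pos hex]
  refine Lp.ext ?_
  exact (hex.choose_spec.ae_eq hp hn hΩ φ.2.1 (toSobolev_fst Ω p φ) (toSobolev_snd Ω p φ)).trans
    hval.symm

lemma rayleigh_toSobolev (hp : 1 < p) (hn : 1 ≤ n) (hΩ : IsBoundedLipschitzDomain Ω)
    (φ : testSpace n) : rayleigh (toSobolev Ω p φ) =
      (∫⁻ x in Ω, ‖gradient (φ : E n → ℝ) x‖ₑ ^ p) /
        ∫⁻ x, ‖(φ : E n → ℝ) x‖ₑ ^ p ∂(surfaceMeasure Ω) := by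
  have := hΩ.isFiniteMeasure hn
  rw [rayleigh, trace_toSobolev hp hn hΩ]
  congr 1
  · refine lintegral_congr_ae ?_
    filter_upwards [toSobolev_snd Ω p φ] with x hx
    rw [hx]
  · have hval := coeFn_boundaryValues Ω p φ
    refine lintegral_congr_ae ?_
    filter_upwards [hval] with x hx
    rw [hx]

end Classes

/-! ### Upper bounds for the eigenvalues from test functions with disjoint supports -/

variable {n : ℕ} {Ω : Set (E n)}

lemma enorm_sum_rpow_of_disjoint {ι F : Type*} [NormedAddCommGroup F] (s : Finset ι) {p : ℝ}
    (hp : 0 < p) (f : ι → F) (hf : ∀ i ∈ s, ∀ j ∈ s, i ≠ j → f i = 0 ∨ f j = 0) :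
    ‖∑ i ∈ s, f i‖ₑ ^ p = ∑ i ∈ s, ‖f i‖ₑ ^ p := by
  by_cases h : ∃ i ∈ s, f i ≠ 0
  · obtain ⟨i, hi, hne⟩ := h
    have h0 : ∀ j ∈ s, j ≠ i → f j = 0 := fun j hj hji => (hf j hj i hi hji).resolve_right hne
    rw [Finset.sum_eq_single_of_mem i hi h0, Finset.sum_eq_single_of_mem i hi fun j hj hji => by
      simp [h0 j hj hji, hp]]
  · push Not at h
    rw [Finset.sum_eq_zero h, Finset.sum_eq_zero fun i hi => by simp [h i hi, hp]]
    simp [hp]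

lemma gradient_eq_zero {u : E n → ℝ} (h : ∀ y, 0 ≤ u y) {x : E n} (hx : u x = 0) :
    gradient u x = 0 := by
  have : IsLocalMin u x := Filter.Eventually.of_forall fun y => by rw [hx]; exact h y
  rw [gradient, this.fderiv_eq_zero, map_zero]

/-- The gradient, as a linear map. -/
def gradientMap (n : ℕ) : testSpace n →ₗ[ℝ] E n → E n where
  toFun φ := gradient (φ : E n → ℝ)
  map_add' := gradient_add'
  map_smul' := gradient_smul'

/-- The linear combinations of a finite family of smooth functions. -/
def combination {k : ℕ} (u : Fin k → testSpace n) : E k →ₗ[ℝ] testSpace n where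
  toFun c := ∑ i, c i • u i
  map_add' c d := by simp [add_smul, Finset.sum_add_distrib]
  map_smul' a c := by simp [mul_smul, Finset.smul_sum]

section Combination

variable {k : ℕ} {u : Fin k → testSpace n} {p : ℝ}

lemma combination_apply (c : E k) (x : E n) :
    (combination u c : E n → ℝ) x = ∑ i, c i • (u i : E n → ℝ) x := by
  simp [combination, Finset.sum_apply]

lemma gradient_combination (c : E k) (x : E n) :
    gradient (combination u c : E n → ℝ) x = ∑ i, c i • gradient (u i : E n → ℝ) x := by
  have : gradientMap n (combination u c) = ∑ i, c i • gradientMap n (u i) := by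
    simp [combination]
  have := congrFun this x
  rw [Finset.sum_apply] at this
  exact this

/-- The `p`-norm to the power `p` of a coefficient vector. -/
def coeffSum (p : ℝ) (c : E k) : ℝ≥0∞ := ∑ i, ‖c i‖ₑ ^ p

lemma coeffSum_ne_top (hp : 0 < p) (c : E k) : coeffSum p c ≠ ⊤ :=
  ENNReal.sum_ne_top.2 fun _ _ => ENNReal.rpow_ne_top_of_nonneg hp.le enorm_ne_top

lemma coeffSum_ne_zero (hp : 0 < p) {c : E k} (hc : c ≠ 0) : coeffSum p c ≠ 0 := by
  intro h
  refine hc (PiLp.ext fun i => ?_)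
  have := (Finset.sum_eq_zero_iff.1 h) i (Finset.mem_univ _)
  rw [ENNReal.rpow_eq_zero_iff_of_pos hp, enorm_eq_zero] at this
  exact this

/-- A family of nonnegative functions with pairwise disjoint supports. -/
structure IsDisjointFamily (u : Fin k → testSpace n) : Prop where
  nonneg : ∀ i y, 0 ≤ (u i : E n → ℝ) y
  disjoint : ∀ i j, i ≠ j →
    Disjoint (Function.support (u i : E n → ℝ)) (Function.support (u j : E n → ℝ))

lemma IsDisjointFamily.eq_zero_or_eq_zero (hu : IsDisjointFamily u) {i j : Fin k} (hij : i ≠ j)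
    (x : E n) : (u i : E n → ℝ) x = 0 ∨ (u j : E n → ℝ) x = 0 := by
  by_contra! h
  exact Set.disjoint_left.1 (hu.disjoint i j hij) h.1 h.2

lemma IsDisjointFamily.enorm_combination (hu : IsDisjointFamily u) (hp : 0 < p) (c : E k)
    (x : E n) : ‖(combination u c : E n → ℝ) x‖ₑ ^ p =
      ∑ i, ‖c i‖ₑ ^ p * ‖(u i : E n → ℝ) x‖ₑ ^ p := by
  rw [combination_apply, enorm_sum_rpow_of_disjoint _ hp]
  · simp_rw [enorm_smul, ENNReal.mul_rpow_of_nonneg _ _ hp.le]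
  · intro i _ j _ hij
    rcases hu.eq_zero_or_eq_zero hij x with h | h <;> simp [h]

lemma IsDisjointFamily.enorm_gradient_combination (hu : IsDisjointFamily u) (hp : 0 < p) (c : E k)
    (x : E n) : ‖gradient (combination u c : E n → ℝ) x‖ₑ ^ p =
      ∑ i, ‖c i‖ₑ ^ p * ‖gradient (u i : E n → ℝ) x‖ₑ ^ p := by
  rw [gradient_combination, enorm_sum_rpow_of_disjoint _ hp]
  · simp_rw [enorm_smul, ENNReal.mul_rpow_of_nonneg _ _ hp.le]
  · intro i _ j _ hij
    rcases hu.eq_zero_or_eq_zero hij x with h | h <;>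
      simp [gradient_eq_zero (hu.nonneg _) h]

lemma IsDisjointFamily.lintegral_gradient_le (hu : IsDisjointFamily u) (hp : 0 < p) {A : ℝ≥0∞}
    (hA : ∀ i, ∫⁻ x in Ω, ‖gradient (u i : E n → ℝ) x‖ₑ ^ p ≤ A) (c : E k) :
    ∫⁻ x in Ω, ‖gradient (combination u c : E n → ℝ) x‖ₑ ^ p ≤ A * coeffSum p c := by
  have hm : ∀ i, Measurable fun x => ‖gradient (u i : E n → ℝ) x‖ₑ ^ p := fun i =>
    (continuous_gradient (u i).2.1).enorm.measurable.pow_const p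
  simp_rw [hu.enorm_gradient_combination hp]
  rw [lintegral_finsetSum _ fun i _ => (hm i).const_mul _, coeffSum, Finset.mul_sum]
  refine Finset.sum_le_sum fun i _ => ?_
  rw [lintegral_const_mul _ (hm i), mul_comm A]
  gcongr
  exact hA i

lemma IsDisjointFamily.le_lintegral (hu : IsDisjointFamily u) (hp : 0 < p) {τ : ℝ≥0∞}
    {μ : Measure (E n)} (hτ : ∀ i, τ ≤ μ {x | (u i : E n → ℝ) x = 1}) (c : E k) :
    τ * coeffSum p c ≤ ∫⁻ x, ‖(combination u c : E n → ℝ) x‖ₑ ^ p ∂μ := by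
  have hm : ∀ i, Measurable fun x => ‖(u i : E n → ℝ) x‖ₑ ^ p := fun i =>
    (u i).2.1.continuous.enorm.measurable.pow_const p
  simp_rw [hu.enorm_combination hp]
  rw [lintegral_finsetSum _ fun i _ => (hm i).const_mul _, coeffSum, Finset.mul_sum]
  refine Finset.sum_le_sum fun i _ => ?_
  rw [lintegral_const_mul _ (hm i), mul_comm τ]
  gcongr
  have hset : MeasurableSet {x | (u i : E n → ℝ) x = 1} :=
    (isClosed_eq (u i).2.1.continuous continuous_const).measurableSet
  calc τ ≤ μ {x | (u i : E n → ℝ) x = 1} := hτ i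
    _ = ∫⁻ x in {x | (u i : E n → ℝ) x = 1}, 1 ∂μ := by simp
    _ ≤ ∫⁻ x in {x | (u i : E n → ℝ) x = 1}, ‖(u i : E n → ℝ) x‖ₑ ^ p ∂μ := by
        refine setLIntegral_mono' hset fun x hx => ?_
        have hx : (u i : E n → ℝ) x = 1 := hx
        simp [hx]
    _ ≤ _ := setLIntegral_le_lintegral _ _

end Combination

/-- Test functions with disjoint supports bound the variational eigenvalues: the unit sphere of
their span has genus `k`, and the Rayleigh quotient on the span is at most the largest of their
Rayleigh quotients. -/
theorem eigenvalue_le {p : ℝ} [hp : Fact (1 < p)] (hn : 1 ≤ n) (hΩ : IsBoundedLipschitzDomain Ω)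
    {k : ℕ} (hk : 1 ≤ k) {u : Fin k → testSpace n} (hu : IsDisjointFamily u) {A τ : ℝ≥0∞}
    (hA : ∀ i, ∫⁻ x in Ω, ‖gradient (u i : E n → ℝ) x‖ₑ ^ p ≤ A)
    (hτ : ∀ i, τ ≤ surfaceMeasure Ω {x | (u i : E n → ℝ) x = 1}) (hτ0 : τ ≠ 0) :
    eigenvalue p Ω k ≤ A / τ := by
  have hfin := hΩ.isFiniteMeasure hn
  have hp0 : 0 < p := one_pos.trans hp.out
  let Φ : E k →ₗ[ℝ] LpPair p Ω := toSobolev Ω p ∘ₗ combination u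
  have hΦ : Continuous Φ := Φ.continuous_of_finiteDimensional
  let T : E k →ₗ[ℝ] Lp ℝ (ENNReal.ofReal p) (surfaceMeasure Ω) :=
    boundaryValues Ω p ∘ₗ combination u
  have hT : Continuous T := T.continuous_of_finiteDimensional
  have htr : ∀ c, trace (Φ c) = T c := fun c => trace_toSobolev hp.out hn hΩ _
  have hne : ∀ c : E k, c ≠ 0 → Φ c ≠ 0 := by
    intro c hc h0
    have h1 : T c = 0 := by
      rw [← htr, h0, ← map_zero Φ, htr, map_zero]
    have h2 : (combination u c : E n → ℝ) =ᵐ[surfaceMeasure Ω] fun _ => (0 : ℝ) := by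
      have h3 := coeFn_boundaryValues Ω p (combination u c)
      have h4 : boundaryValues Ω p (combination u c) = 0 := h1
      rw [h4] at h3
      exact h3.symm.trans (Lp.coeFn_zero _ _ _)
    have h5 : ∫⁻ x, ‖(combination u c : E n → ℝ) x‖ₑ ^ p ∂surfaceMeasure Ω = 0 := by
      rw [lintegral_congr_ae (g := fun _ => 0), lintegral_zero]
      filter_upwards [h2] with x hx
      simp [hx, hp0]
    have h6 := hu.le_lintegral hp0 hτ c
    rw [h5, nonpos_iff_eq_zero, mul_eq_zero] at h6
    exact h6.elim hτ0 (coeffSum_ne_zero hp0 hc)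
  have hsph : ∀ c ∈ Metric.sphere (0 : E k) 1, c ≠ 0 := fun c hc =>
    ne_zero_of_mem_unit_sphere ⟨c, hc⟩
  have hmem : Φ '' Metric.sphere 0 1 ∈ Gam p Ω k := by
    refine ⟨?_, ?_, ?_, ?_, le_genus_image_sphere Φ hΦ (map_neg Φ)⟩
    · exact ⟨_, EuclideanSpace.single ⟨0, hk⟩ 1, by simp, rfl⟩
    · rintro _ ⟨c, hc, rfl⟩
      exact ⟨toSobolev_mem_W1p Ω p _, hne c (hsph c hc)⟩
    · have heq : Φ '' Metric.sphere 0 1 ∩ {w | ‖trace w‖ = 1} =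
          Φ '' (Metric.sphere 0 1 ∩ {c | ‖T c‖ = 1}) := by
        ext w
        constructor
        · rintro ⟨⟨c, hc, rfl⟩, hw⟩
          exact ⟨c, ⟨hc, (congrArg norm (htr c)).symm.trans hw⟩, rfl⟩
        · rintro ⟨c, ⟨hc, hw⟩, rfl⟩
          refine ⟨⟨c, hc, rfl⟩, ?_⟩
          show ‖trace (Φ c)‖ = 1
          rw [htr]
          exact hw
      rw [heq]
      exact ((isCompact_sphere _ _).inter_right
        (isClosed_eq hT.norm continuous_const)).image hΦ
    · rintro _ ⟨c, hc, rfl⟩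
      exact ⟨-c, by simpa using hc, map_neg Φ c⟩
  refine (iInf₂_le _ hmem).trans (iSup₂_le ?_)
  rintro _ ⟨c, hc, rfl⟩
  have hr : rayleigh (Φ c) = _ := rayleigh_toSobolev hp.out hn hΩ (combination u c)
  rw [hr, ← ENNReal.mul_div_mul_right A τ (coeffSum_ne_zero hp0 (hsph c hc))
    (coeffSum_ne_top hp0 c)]
  exact ENNReal.div_le_div (hu.lintegral_gradient_le hp0 hA c) (hu.le_lintegral hp0 hτ c)

/-! ### Energy of a test function -/

/-- The energy of a nonnegative function whose gradient is controlled by finitely many balls. -/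
lemma lintegral_gradient_rpow_le {p : ℝ} (hp : 1 ≤ p) {L : ℝ} (hL : 0 ≤ L) (hΩ : IsOpen Ω)
    {u : E n → ℝ} (hu : Continuous u) (hu0 : ∀ y, 0 ≤ u y) {ι : Type*} (B : Finset ι) (z : ι → E n)
    (s : ι → ℝ) (hs : ∀ i ∈ B, 0 < s i) (h : ∀ y, ‖fderiv ℝ u y‖ ≤
      ∑ i ∈ B, (Metric.closedBall (z i) (2 * s i)).indicator (fun _ => L / s i) y) :
    ∫⁻ y in Ω, ‖gradient u y‖ₑ ^ p ≤ (B.card : ℝ≥0∞) ^ (p - 1) *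
      ∑ i ∈ B, ENNReal.ofReal (L / s i) ^ p *
        volume (Metric.closedBall (z i) (2 * s i) ∩ (Ω ∩ Function.support u)) := by
  have hp0 : 0 < p := one_pos.trans_le hp
  have hV : MeasurableSet (Ω ∩ Function.support u) :=
    (hΩ.inter hu.isOpen_support).measurableSet
  have hm : ∀ i, Measurable ((Metric.closedBall (z i) (2 * s i)).indicator
      fun _ => ENNReal.ofReal (L / s i) ^ p) := fun i =>
    measurable_const.indicator Metric.isClosed_closedBall.measurableSet
  -- a nonnegative function has zero gradient where it vanishes
  calc ∫⁻ y in Ω, ‖gradient u y‖ₑ ^ p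
      ≤ ∫⁻ y in Ω ∩ Function.support u, ‖gradient u y‖ₑ ^ p := by
        rw [← lintegral_indicator hΩ.measurableSet, ← lintegral_indicator hV]
        refine lintegral_mono fun y => ?_
        by_cases hy : y ∈ Ω
        · by_cases hy' : u y = 0
          · rw [Set.indicator_of_mem hy, gradient_eq_zero hu0 hy']
            simp [hp0]
          · rw [Set.indicator_of_mem hy,
              Set.indicator_of_mem (show y ∈ Ω ∩ Function.support u from ⟨hy, hy'⟩)]
        · rw [Set.indicator_of_notMem hy]
          exact zero_le
    _ ≤ ∫⁻ y in Ω ∩ Function.support u, (B.card : ℝ≥0∞) ^ (p - 1) * ∑ i ∈ B,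
          (Metric.closedBall (z i) (2 * s i)).indicator
            (fun _ => ENNReal.ofReal (L / s i) ^ p) y := by
        refine lintegral_mono fun y => ?_
        have hpos : ∀ i ∈ B, 0 ≤ (Metric.closedBall (z i) (2 * s i)).indicator
            (fun _ => L / s i) y := fun i hi =>
          Set.indicator_nonneg (fun _ _ => div_nonneg hL (hs i hi).le) y
        have h1 : ‖gradient u y‖ₑ ≤ ∑ i ∈ B, ENNReal.ofReal
            ((Metric.closedBall (z i) (2 * s i)).indicator (fun _ => L / s i) y) := by
          rw [enorm_gradient, ← ofReal_norm, ← ENNReal.ofReal_sum_of_nonneg hpos]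
          exact ENNReal.ofReal_le_ofReal (h y)
        refine (ENNReal.rpow_le_rpow h1 hp0.le).trans
          ((ENNReal.rpow_sum_le_const_mul_sum_rpow _ _ hp).trans (le_of_eq ?_))
        congr 1
        refine Finset.sum_congr rfl fun i _ => ?_
        by_cases hy : y ∈ Metric.closedBall (z i) (2 * s i)
        · rw [Set.indicator_of_mem hy, Set.indicator_of_mem hy]
        · rw [Set.indicator_of_notMem hy, Set.indicator_of_notMem hy]
          simp [hp0]
    _ = _ := by
        rw [lintegral_const_mul _ (Finset.measurable_fun_sum _ fun i _ => hm i),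
          lintegral_finsetSum _ fun i _ => hm i]
        congr 1
        refine Finset.sum_congr rfl fun i _ => ?_
        rw [lintegral_indicator_const Metric.isClosed_closedBall.measurableSet,
          Measure.restrict_apply Metric.isClosed_closedBall.measurableSet]

lemma volume_closedBall_eq (z : E n) {s : ℝ} (hs : 0 ≤ s) :
    volume (Metric.closedBall z s) = ENNReal.ofReal (s ^ n) * unitBallVolume n := by
  rw [Measure.addHaar_closedBall _ _ hs, finrank_euclideanSpace_fin, unitBallVolume]

/-- The contribution of one ball to the energy, for `p ≤ n`. -/
lemma ball_energy_le_of_le {p : ℝ} (hp : 1 ≤ p) (hpn : p ≤ n) {L s : ℝ} (hL : 0 ≤ L) (hs : 0 < s)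
    (z : E n) {V : Set (E n)} {v : ℝ≥0∞} (hv : volume V ≤ v) :
    ENNReal.ofReal (L / s) ^ p * volume (Metric.closedBall z (2 * s) ∩ V) ≤
      ENNReal.ofReal ((2 * L) ^ p) * unitBallVolume n ^ (p / n) * v ^ ((n - p) / n) := by
  have hn : (0 : ℝ) < n := by linarith
  have hp0 : 0 ≤ p := by linarith
  have e1 : (n - p) / (n : ℝ) + p / n = 1 := by field_simp; ring
  have h1 : volume (Metric.closedBall z (2 * s) ∩ V) ≤
      v ^ ((n - p) / n) * (ENNReal.ofReal ((2 * s) ^ n) * unitBallVolume n) ^ (p / n) := by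
    rw [← volume_closedBall_eq z (by positivity)]
    calc _ = volume (Metric.closedBall z (2 * s) ∩ V) ^ ((n - p) / (n : ℝ)) *
          volume (Metric.closedBall z (2 * s) ∩ V) ^ (p / n) := by
          rw [← ENNReal.rpow_add_of_nonneg _ _ (div_nonneg (by linarith) hn.le) (by positivity),
            e1, ENNReal.rpow_one]
      _ ≤ _ := by
          have h2 : 0 ≤ (n - p) / (n : ℝ) := div_nonneg (by linarith) hn.le
          gcongr
          · exact (measure_mono Set.inter_subset_right).trans hv
          · exact Set.inter_subset_left
  have h2 : ENNReal.ofReal (L / s) ^ p * ENNReal.ofReal ((2 * s) ^ n) ^ (p / n) =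
      ENNReal.ofReal ((2 * L) ^ p) := by
    rw [ENNReal.ofReal_rpow_of_nonneg (by positivity) hp0,
      ENNReal.ofReal_rpow_of_nonneg (by positivity) (by positivity),
      ← ENNReal.ofReal_mul (by positivity), ← Real.rpow_natCast, ← Real.rpow_mul (by positivity),
      mul_div_cancel₀ _ hn.ne', ← Real.mul_rpow (by positivity) (by positivity)]
    congr 2
    field_simp
  calc _ ≤ ENNReal.ofReal (L / s) ^ p * (v ^ ((n - p) / n) *
        (ENNReal.ofReal ((2 * s) ^ n) * unitBallVolume n) ^ (p / n)) := by gcongr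
    _ = (ENNReal.ofReal (L / s) ^ p * ENNReal.ofReal ((2 * s) ^ n) ^ (p / n)) *
        unitBallVolume n ^ (p / n) * v ^ ((n - p) / n) := by
        rw [ENNReal.mul_rpow_of_nonneg _ _ (by positivity)]
        ring
    _ = _ := by rw [h2]

/-- The contribution of one ball of radius at least `ρ` to the energy, for `n ≤ p`. -/
lemma ball_energy_le_of_ge {p : ℝ} (hpn : n ≤ p) {L s ρ : ℝ} (hL : 0 ≤ L)
    (hρ : 0 < ρ) (hs : ρ ≤ s) (z : E n) (V : Set (E n)) :
    ENNReal.ofReal (L / s) ^ p * volume (Metric.closedBall z (2 * s) ∩ V) ≤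
      ENNReal.ofReal (L ^ p * 2 ^ n) * unitBallVolume n * ENNReal.ofReal (ρ ^ (n - p)) := by
  have hs0 : 0 < s := hρ.trans_le hs
  have hp0 : 0 ≤ p := (Nat.cast_nonneg n).trans hpn
  have h1 : (L / s) ^ p * (2 * s) ^ n ≤ L ^ p * 2 ^ n * ρ ^ (n - p) := by
    have e : (L / s) ^ p * (2 * s) ^ n = L ^ p * 2 ^ n * s ^ (n - p) := by
      rw [Real.div_rpow hL hs0.le, mul_pow, Real.rpow_sub hs0, Real.rpow_natCast]
      ring
    rw [e]
    have := Real.rpow_le_rpow_of_nonpos hρ hs (sub_nonpos.2 hpn)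
    gcongr
  calc _ ≤ ENNReal.ofReal (L / s) ^ p * (ENNReal.ofReal ((2 * s) ^ n) * unitBallVolume n) := by
        rw [← volume_closedBall_eq z (by positivity)]
        gcongr
        exact Set.inter_subset_left
    _ = ENNReal.ofReal ((L / s) ^ p * (2 * s) ^ n) * unitBallVolume n := by
        rw [ENNReal.ofReal_rpow_of_nonneg (by positivity) hp0, ← mul_assoc,
          ← ENNReal.ofReal_mul (by positivity)]
    _ ≤ ENNReal.ofReal (L ^ p * 2 ^ n * ρ ^ (n - p)) * unitBallVolume n := by gcongr
    _ = _ := by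
        rw [ENNReal.ofReal_mul (by positivity)]
        ring

/-! ### Selection of the test functions and conclusion -/

variable {n : ℕ} {Ω : Set (E n)}

lemma surfaceMeasure_univ : surfaceMeasure Ω Set.univ = boundaryArea Ω := by
  rw [surfaceMeasure_eq_frontier_inter, Set.inter_univ, boundaryArea]

/-- Markov's inequality for finite sums. -/
lemma card_filter_lt_le {ι : Type*} [DecidableEq ι] (s : Finset ι) (f : ι → ℝ≥0∞) {a : ℝ≥0∞} {k : ℕ}
    (ha0 : a ≠ 0) (ha : a ≠ ⊤) [DecidablePred fun i => a < f i] (h : ∑ i ∈ s, f i ≤ k * a) :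
    (s.filter fun i => a < f i).card ≤ k := by
  have h1 : ((s.filter fun i => a < f i).card : ℝ≥0∞) * a ≤ k * a := by
    rw [← nsmul_eq_mul]
    calc _ ≤ ∑ i ∈ s.filter fun i => a < f i, f i :=
          Finset.card_nsmul_le_sum _ _ _ fun i hi => (Finset.mem_filter.1 hi).2.le
      _ ≤ ∑ i ∈ s, f i := Finset.sum_le_sum_of_subset (Finset.filter_subset _ _)
      _ ≤ _ := h
  exact_mod_cast (ENNReal.mul_le_mul_iff_left ha0 ha).1 h1

/-- Test functions that each see a fixed proportion of `|∂Ω| / k` of the boundary and of which the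
supports occupy at most `|Ω| / k` of the domain. Four times as many functions are constructed, and
those with many holes or large supports are discarded. -/
theorem exists_disjointFamily (hn : 1 ≤ n) : ∃ (c Q : ℕ) (L : ℝ), 0 < c ∧ 0 < Q ∧ 0 < L ∧
    ∀ Ω : Set (E n), IsBoundedLipschitzDomain Ω → ∀ k : ℕ, 1 ≤ k → ∀ ρ : ℝ, 0 < ρ →
      (∀ x, surfaceMeasure Ω (Metric.ball x ρ) < boundaryArea Ω / (c * k)) →
      ∃ u : Fin k → testSpace n, IsDisjointFamily u ∧
        (∀ i, boundaryArea Ω / (c * k) ≤ surfaceMeasure Ω {x | (u i : E n → ℝ) x = 1}) ∧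
        ∀ i, volume (Ω ∩ Function.support (u i : E n → ℝ)) ≤ volume Ω / k ∧
          ∃ (B : Finset ℕ) (z : ℕ → E n) (s : ℕ → ℝ), B.card ≤ Q ∧ (∀ b ∈ B, ρ ≤ s b) ∧
            ∀ y, ‖fderiv ℝ (u i : E n → ℝ) y‖ ≤
              ∑ b ∈ B, (Metric.closedBall (z b) (2 * s b)).indicator (fun _ => L / s b) y := by
  classical
  obtain ⟨C, L, hL, hC⟩ := exists_test_functions n
  refine ⟨4 * C + 1, 4 * (C + 2), L, by omega, by omega, hL, fun Ω hΩ k hk ρ hρ hsmall => ?_⟩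
  have hfin := hΩ.isFiniteMeasure hn
  set τ := boundaryArea Ω / ((4 * C + 1 : ℕ) * k) with hτ
  have hk0 : (k : ℝ≥0∞) ≠ 0 := by exact_mod_cast (by omega : k ≠ 0)
  have hkt : (k : ℝ≥0∞) ≠ ⊤ := ENNReal.natCast_ne_top k
  obtain ⟨R, -, hR⟩ := hΩ.exists_ball
  have hR0 : surfaceMeasure Ω (Metric.ball 0 R)ᶜ = 0 := by
    rw [surfaceMeasure_eq_frontier_inter, ← measure_empty (μ := surfaceMeasure Ω)]
    congr 1
    exact Set.disjoint_compl_right_iff_subset.2 hR |>.inter_eq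
  have hN : ((4 * k : ℕ) : ℝ≥0∞) * (C * τ) + τ ≤ surfaceMeasure Ω Set.univ := by
    have hc0 : (((4 * C + 1 : ℕ) : ℝ≥0∞) * k) ≠ 0 :=
      mul_ne_zero (by exact_mod_cast (by omega : 4 * C + 1 ≠ 0)) hk0
    have hct : (((4 * C + 1 : ℕ) : ℝ≥0∞) * k) ≠ ⊤ :=
      ENNReal.mul_ne_top (ENNReal.natCast_ne_top _) hkt
    have hM : τ * (((4 * C + 1 : ℕ) : ℝ≥0∞) * k) = boundaryArea Ω := ENNReal.div_mul_cancel hc0 hct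
    rw [surfaceMeasure_univ, ← hM]
    have h1 : (1 : ℝ≥0∞) ≤ k := by exact_mod_cast hk
    calc _ ≤ ((4 * k : ℕ) : ℝ≥0∞) * (C * τ) + k * τ := by
          gcongr
          exact le_mul_of_one_le_left' h1
      _ = _ := by push_cast; ring
  obtain ⟨u, B, z, s, hu, hdisj, hcard⟩ := hC (surfaceMeasure Ω) R hR0 τ ρ hρ hsmall (4 * k) hN
  have hdisj' : ∀ i < 4 * k, ∀ j < 4 * k, i ≠ j →
      Disjoint (Function.support (u i)) (Function.support (u j)) := by
    intro i hi j hj hij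
    rcases lt_or_gt_of_ne hij with h | h
    · exact hdisj j hj i h
    · exact (hdisj i hi j h).symm
  have hΩ0 : volume Ω ≠ 0 := (hΩ.isOpen.measure_pos _ hΩ.isConnected.nonempty).ne'
  have hΩt : volume Ω ≠ ⊤ := hΩ.isBounded.measure_lt_top.ne
  let V : ℕ → ℝ≥0∞ := fun j => volume (Ω ∩ Function.support (u j))
  have hbad1 : ((Finset.range (4 * k)).filter fun j =>
      ((4 * (C + 2) : ℕ) : ℝ≥0∞) < ((B j).card : ℝ≥0∞)).card ≤ k := by
    refine card_filter_lt_le _ _ (by exact_mod_cast (by omega : 4 * (C + 2) ≠ 0))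
      (ENNReal.natCast_ne_top _) ?_
    rw [← Nat.cast_sum, ← Nat.cast_mul]
    exact_mod_cast hcard.trans (le_of_eq (by ring))
  have hbad2 : ((Finset.range (4 * k)).filter fun j => volume Ω / k < V j).card ≤ k := by
    refine card_filter_lt_le _ _ (ENNReal.div_ne_zero.2 ⟨hΩ0, hkt⟩)
      (ENNReal.div_ne_top hΩt hk0) ?_
    rw [ENNReal.mul_div_cancel hk0 hkt, ← measure_biUnion_finset]
    · exact measure_mono (Set.iUnion₂_subset fun _ _ => Set.inter_subset_left)
    · intro i hi j hj hij
      exact (hdisj' i (Finset.mem_range.1 hi) j (Finset.mem_range.1 hj) hij).mono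
        Set.inter_subset_right Set.inter_subset_right
    · intro j hj
      exact (hΩ.isOpen.inter
        (hu j (Finset.mem_range.1 hj)).1.continuous.isOpen_support).measurableSet
  set G := (Finset.range (4 * k)).filter fun j => (B j).card ≤ 4 * (C + 2) ∧ V j ≤ volume Ω / k
    with hG
  have hGcard : k ≤ G.card := by
    have hsub : Finset.range (4 * k) ⊆ G ∪ (((Finset.range (4 * k)).filter fun j =>
        ((4 * (C + 2) : ℕ) : ℝ≥0∞) < ((B j).card : ℝ≥0∞)) ∪
        ((Finset.range (4 * k)).filter fun j => volume Ω / k < V j)) := by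
      intro j hj
      by_cases h1 : (B j).card ≤ 4 * (C + 2)
      · by_cases h2 : V j ≤ volume Ω / k
        · exact Finset.mem_union_left _ (Finset.mem_filter.2 ⟨hj, h1, h2⟩)
        · exact Finset.mem_union_right _ (Finset.mem_union_right _
            (Finset.mem_filter.2 ⟨hj, not_le.1 h2⟩))
      · refine Finset.mem_union_right _ (Finset.mem_union_left _ (Finset.mem_filter.2 ⟨hj, ?_⟩))
        exact_mod_cast not_le.1 h1
    have h1 := Finset.card_le_card hsub
    have h2 := Finset.card_union_le G (((Finset.range (4 * k)).filter fun j =>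
        ((4 * (C + 2) : ℕ) : ℝ≥0∞) < ((B j).card : ℝ≥0∞)) ∪
        ((Finset.range (4 * k)).filter fun j => volume Ω / k < V j))
    have h3 := Finset.card_union_le ((Finset.range (4 * k)).filter fun j =>
        ((4 * (C + 2) : ℕ) : ℝ≥0∞) < ((B j).card : ℝ≥0∞))
        ((Finset.range (4 * k)).filter fun j => volume Ω / k < V j)
    rw [Finset.card_range] at h1
    omega
  obtain ⟨J, hJG, hJ⟩ := Finset.exists_subset_card_eq hGcard
  let a : Fin k ↪o ℕ := J.orderEmbOfFin hJ
  have ha : ∀ i, a i < 4 * k ∧ (B (a i)).card ≤ 4 * (C + 2) ∧ V (a i) ≤ volume Ω / k := by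
    intro i
    have := Finset.mem_filter.1 (hJG (J.orderEmbOfFin_mem hJ i))
    exact ⟨Finset.mem_range.1 this.1, this.2⟩
  refine ⟨fun i => ⟨u (a i), (hu _ (ha i).1).1, (hu _ (ha i).1).2.1⟩, ⟨?_, ?_⟩, ?_, ?_⟩
  · exact fun i => (hu _ (ha i).1).2.2.1
  · exact fun i j hij => hdisj' _ (ha i).1 _ (ha j).1 fun h => hij (a.injective h)
  · exact fun i => (hu _ (ha i).1).2.2.2.1
  · exact fun i => ⟨(ha i).2.2, B (a i), z (a i), s (a i), (ha i).2.1, (hu _ (ha i).1).2.2.2.2⟩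

/-- The bounds on the eigenvalues before the choice of `ρ`. -/
theorem exists_eigenvalue_le (hn : 1 ≤ n) (p : ℝ) [hp : Fact (1 < p)] :
    ∃ (c Q : ℕ) (L : ℝ), 0 < c ∧ 0 < Q ∧ 0 < L ∧
    ∀ Ω : Set (E n), IsBoundedLipschitzDomain Ω → ∀ k : ℕ, 1 ≤ k → ∀ ρ : ℝ, 0 < ρ →
      (∀ x, surfaceMeasure Ω (Metric.ball x ρ) < boundaryArea Ω / (c * k)) →
      (p ≤ n → eigenvalue p Ω k ≤ (Q : ℝ≥0∞) ^ (p - 1) * (Q * (ENNReal.ofReal ((2 * L) ^ p) *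
        unitBallVolume n ^ (p / n) * (volume Ω / k) ^ ((n - p) / n))) /
          (boundaryArea Ω / (c * k))) ∧
      (n ≤ p → eigenvalue p Ω k ≤ (Q : ℝ≥0∞) ^ (p - 1) * (Q * (ENNReal.ofReal (L ^ p * 2 ^ n) *
        unitBallVolume n * ENNReal.ofReal (ρ ^ (n - p)))) / (boundaryArea Ω / (c * k))) := by
  obtain ⟨c, Q, L, hc, hQ, hL, h⟩ := exists_disjointFamily hn
  refine ⟨c, Q, L, hc, hQ, hL, fun Ω hΩ k hk ρ hρ hsmall => ?_⟩
  obtain ⟨u, hu, hτ, hB⟩ := h Ω hΩ k hk ρ hρ hsmall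
  have hτ0 : boundaryArea Ω / (c * k) ≠ 0 := (pos_of_gt (hsmall 0)).ne'
  have hp1 : 0 ≤ p - 1 := by linarith [hp.out]
  have key : ∀ X : ℝ≥0∞, (∀ (i : Fin k) (z : E n) (s : ℝ), ρ ≤ s → ENNReal.ofReal (L / s) ^ p *
      volume (Metric.closedBall z (2 * s) ∩ (Ω ∩ Function.support (u i : E n → ℝ))) ≤ X) →
      eigenvalue p Ω k ≤ (Q : ℝ≥0∞) ^ (p - 1) * (Q * X) / (boundaryArea Ω / (c * k)) := by
    intro X hX
    refine eigenvalue_le hn hΩ hk hu (fun i => ?_) hτ hτ0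
    obtain ⟨-, B, z, s, hBQ, hs, hgrad⟩ := hB i
    refine (lintegral_gradient_rpow_le hp.out.le hL.le hΩ.isOpen (u i).2.1.continuous
      (hu.nonneg i) B z s (fun b hb => hρ.trans_le (hs b hb)) hgrad).trans ?_
    gcongr
    calc _ ≤ ∑ b ∈ B, X := Finset.sum_le_sum fun b hb => hX i _ _ (hs b hb)
      _ = B.card * X := by simp
      _ ≤ Q * X := by gcongr
  exact ⟨fun hpn => key _ fun i z s hs =>
      ball_energy_le_of_le hp.out.le hpn hL.le (hρ.trans_le hs) z (hB i).1,
    fun hpn => key _ fun i z s hs => ball_energy_le_of_ge hpn hL.le hρ hs z _⟩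

/-- A scale, in terms of the distortion, at which the surface measure of balls is less than `t`. -/
lemma exists_scale (hn : 2 ≤ n) {d w t : ℝ} (hd : 0 < d) (hw : 0 < w) (ht : 0 < t)
    (hD : distortion Ω = ENNReal.ofReal d) (hW : unitBallVolume (n - 1) = ENNReal.ofReal w)
    (x : E n) :
    surfaceMeasure Ω (Metric.ball x ((t / (2 * d * w)) ^ ((1 : ℝ) / (n - 1)))) <
      ENNReal.ofReal t := by
  have hn1 : (0 : ℝ) < n - 1 := by
    have : (2 : ℝ) ≤ n := by exact_mod_cast hn
    linarith
  set ρ := (t / (2 * d * w)) ^ ((1 : ℝ) / (n - 1)) with hρ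
  have hρ0 : 0 < ρ := by positivity
  have hpow : ρ ^ (n - 1) = t / (2 * d * w) := by
    rw [hρ, ← Real.rpow_natCast, ← Real.rpow_mul (by positivity), Nat.cast_sub (by omega),
      Nat.cast_one, one_div_mul_cancel hn1.ne', Real.rpow_one]
  refine (surfaceMeasure_ball_le_distortion x hρ0).trans_lt ?_
  rw [hD, hW, ← ENNReal.ofReal_pow hρ0.le, hpow, ← ENNReal.ofReal_mul hw.le,
    ← ENNReal.ofReal_mul hd.le, ENNReal.ofReal_lt_ofReal_iff ht]
  have : d * (w * (t / (2 * d * w))) = t / 2 := by field_simp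
  rw [this]
  exact half_lt_self ht

lemma exists_ofReal {a : ℝ≥0∞} (h0 : a ≠ 0) (ht : a ≠ ⊤) : ∃ r : ℝ, 0 < r ∧ a = ENNReal.ofReal r :=
  ⟨a.toReal, ENNReal.toReal_pos h0 ht, (ENNReal.ofReal_toReal ht).symm⟩

lemma IsBoundedLipschitzDomain.distortion_ne_zero (hΩ : IsBoundedLipschitzDomain Ω)
    (h : boundaryArea Ω ≠ 0) : distortion Ω ≠ 0 := by
  intro h0
  obtain ⟨R, hR, hsub⟩ := hΩ.exists_ball
  refine h (le_antisymm ?_ zero_le)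
  have := surfaceMeasure_ball_le_distortion (Ω := Ω) 0 hR
  rw [h0, zero_mul] at this
  exact (measure_mono hsub).trans this

end

end Steklov

theorem theorem1p1 (n : ℕ) (hn : 2 ≤ n) (p : ℝ) [hp : Fact (1 < p)] :
    (p ≤ n → ∃ C : ℝ, 0 < C ∧ ∀ Ω : Set (Steklov.E n), Steklov.IsBoundedLipschitzDomain Ω →
      ∀ k : ℕ, 1 ≤ k →
        Steklov.boundaryArea Ω ^ ((p - 1) / ((n : ℝ) - 1)) * Steklov.eigenvalue p Ω k ≤
          ENNReal.ofReal C / Steklov.isoperimetricRatio Ω ^ (((n : ℝ) - p) / ((n : ℝ) - 1)) *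
            (k : ℝ≥0∞) ^ (p / (n : ℝ))) ∧
    ((n : ℝ) < p → ∃ C' : ℝ, 0 < C' ∧ ∀ Ω : Set (Steklov.E n),
      Steklov.IsBoundedLipschitzDomain Ω →
        Steklov.distortion Ω ≠ ⊤ ∧
        ∀ k : ℕ, 1 ≤ k →
          Steklov.boundaryArea Ω ^ ((p - 1) / ((n : ℝ) - 1)) * Steklov.eigenvalue p Ω k ≤
            ENNReal.ofReal C' * Steklov.distortion Ω ^ ((p - (n : ℝ)) / ((n : ℝ) - 1)) *
              (k : ℝ≥0∞) ^ ((p - 1) / ((n : ℝ) - 1))) := by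
  have hn1 : 1 ≤ n := by omega
  have hnr : (2 : ℝ) ≤ n := by exact_mod_cast hn
  have hnp : (0 : ℝ) < n := by linarith
  have hm1 : (0 : ℝ) < n - 1 := by linarith
  have hp1 : 0 < p - 1 := sub_pos.2 hp.out
  obtain ⟨c, Q, L, hc, hQ, hL, hmain⟩ := Steklov.exists_eigenvalue_le (n := n) hn1 p
  obtain ⟨w, hw, hwe⟩ := Steklov.exists_ofReal (Steklov.unitBallVolume_pos n).ne'
    (Steklov.unitBallVolume_ne_top n)
  obtain ⟨w', hw', hwe'⟩ := Steklov.exists_ofReal (Steklov.unitBallVolume_pos (n - 1)).ne'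
    (Steklov.unitBallVolume_ne_top (n - 1))
  have hc' : (0 : ℝ) < c := by exact_mod_cast hc
  have hQ' : (0 : ℝ) < Q := by exact_mod_cast hQ
  have hce : (c : ℝ≥0∞) = ENNReal.ofReal c := (ENNReal.ofReal_natCast c).symm
  have hQe : (Q : ℝ≥0∞) = ENNReal.ofReal Q := (ENNReal.ofReal_natCast Q).symm
  -- for a boundary of positive area all quantities are positive real numbers
  have hpos : ∀ Ω : Set (Steklov.E n), Steklov.IsBoundedLipschitzDomain Ω →
      Steklov.boundaryArea Ω ≠ 0 → ∃ m v d : ℝ, 0 < m ∧ 0 < v ∧ 0 < d ∧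
        Steklov.boundaryArea Ω = ENNReal.ofReal m ∧ volume Ω = ENNReal.ofReal v ∧
        Steklov.distortion Ω = ENNReal.ofReal d ∧ ∀ k : ℕ, 1 ≤ k → ∀ x,
          Steklov.surfaceMeasure Ω (Metric.ball x
            ((m / (c * k) / (2 * d * w')) ^ ((1 : ℝ) / (n - 1)))) <
            Steklov.boundaryArea Ω / (c * k) := by
    intro Ω hΩ h0
    have hfin := hΩ.isFiniteMeasure hn1
    obtain ⟨m, hm, hme⟩ := Steklov.exists_ofReal h0 (measure_ne_top (Steklov.surfaceMeasure Ω) _)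
    obtain ⟨v, hv, hve⟩ := Steklov.exists_ofReal
      (hΩ.isOpen.measure_pos volume hΩ.isConnected.nonempty).ne' hΩ.isBounded.measure_lt_top.ne
    obtain ⟨d, hd, hde⟩ := Steklov.exists_ofReal (hΩ.distortion_ne_zero h0)
      (hΩ.distortion_ne_top hn1)
    refine ⟨m, v, d, hm, hv, hd, hme, hve, hde, fun k hk x => ?_⟩
    have hk' : (0 : ℝ) < k := by exact_mod_cast hk
    have := Steklov.exists_scale (t := m / (c * k)) hn hd hw' (by positivity) hde hwe' x
    rwa [ENNReal.ofReal_div_of_pos (by positivity), ← hme, ENNReal.ofReal_mul hc'.le, ← hce,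
      ENNReal.ofReal_natCast] at this
  have hzero : ∀ Ω : Set (Steklov.E n), Steklov.boundaryArea Ω = 0 → ∀ x : ℝ≥0∞,
      Steklov.boundaryArea Ω ^ ((p - 1) / ((n : ℝ) - 1)) * x = 0 := by
    intro Ω h0 x
    rw [h0, ENNReal.zero_rpow_of_pos (by positivity), zero_mul]
  constructor
  · intro hpn
    refine ⟨c * (Q ^ (p - 1) * (Q * ((2 * L) ^ p * w ^ (p / n)))), by positivity,
      fun Ω hΩ k hk => ?_⟩
    by_cases h0 : Steklov.boundaryArea Ω = 0
    · rw [hzero Ω h0]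
      exact zero_le
    obtain ⟨m, v, d, hm, hv, hd, hme, hve, hde, hball⟩ := hpos Ω hΩ h0
    have hk' : (0 : ℝ) < k := by exact_mod_cast hk
    have hke : (k : ℝ≥0∞) = ENNReal.ofReal k := (ENNReal.ofReal_natCast k).symm
    have heig := (hmain Ω hΩ k hk _ (by positivity) (hball k hk)).1 hpn
    refine (mul_le_mul_right heig _).trans (le_of_eq ?_)
    rw [Steklov.isoperimetricRatio, hme, hve, hke, hce, hQe, hwe,
      ← ENNReal.ofReal_div_of_pos hk', ← ENNReal.ofReal_mul hc'.le,
      ← ENNReal.ofReal_div_of_pos (by positivity), ENNReal.ofReal_rpow_of_pos hm,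
      ENNReal.ofReal_rpow_of_pos hQ', ENNReal.ofReal_rpow_of_pos hw,
      ENNReal.ofReal_rpow_of_pos (by positivity), ENNReal.ofReal_rpow_of_pos hv,
      ENNReal.ofReal_rpow_of_pos hk', ← ENNReal.ofReal_div_of_pos (by positivity),
      ENNReal.ofReal_rpow_of_pos (by positivity), ← ENNReal.ofReal_mul (by positivity),
      ← ENNReal.ofReal_mul (by positivity), ← ENNReal.ofReal_mul (by positivity),
      ← ENNReal.ofReal_mul (by positivity), ← ENNReal.ofReal_div_of_pos (by positivity),
      ← ENNReal.ofReal_mul (by positivity), ← ENNReal.ofReal_div_of_pos (by positivity),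
      ← ENNReal.ofReal_mul (by positivity)]
    congr 1
    have e1 : (p - 1) / ((n : ℝ) - 1) = 1 - (n - p) / (n - 1) := by field_simp; ring
    have e2 : p / (n : ℝ) = 1 - (n - p) / n := by field_simp; ring
    have e3 : ((n : ℝ) - 1) / n * ((n - p) / (n - 1)) = (n - p) / n := by field_simp
    have e4 : (k : ℝ) ^ (p / (n : ℝ)) = k / k ^ (((n : ℝ) - p) / n) := by
      rw [e2, Real.rpow_sub hk', Real.rpow_one]
    have hm0 : m ^ (((n : ℝ) - p) / (n - 1)) ≠ 0 := (Real.rpow_pos_of_pos hm _).ne'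
    have hk0 : (k : ℝ) ^ (((n : ℝ) - p) / n) ≠ 0 := (Real.rpow_pos_of_pos hk' _).ne'
    have hv0 : v ^ (((n : ℝ) - p) / n) ≠ 0 := (Real.rpow_pos_of_pos hv _).ne'
    rw [e4, e1, Real.rpow_sub hm, Real.rpow_one, Real.div_rpow hm.le (by positivity),
      ← Real.rpow_mul hv.le, e3, Real.div_rpow hv.le hk'.le]
    generalize (Q : ℝ) ^ (p - 1) = q₁
    generalize (2 * L) ^ p = q₂
    generalize w ^ (p / (n : ℝ)) = q₃
    generalize m ^ (((n : ℝ) - p) / (n - 1)) = m₁ at *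
    generalize (k : ℝ) ^ (((n : ℝ) - p) / n) = k₁ at *
    generalize v ^ (((n : ℝ) - p) / n) = v₁ at *
    field_simp
  · intro hpn
    have he : 0 < (p - n) / ((n : ℝ) - 1) := div_pos (sub_pos.2 hpn) hm1
    refine ⟨c * (Q ^ (p - 1) * (Q * (L ^ p * 2 ^ n * w))) *
      (2 * c * w') ^ ((p - n) / ((n : ℝ) - 1)), by positivity,
      fun Ω hΩ => ⟨hΩ.distortion_ne_top hn1, fun k hk => ?_⟩⟩
    by_cases h0 : Steklov.boundaryArea Ω = 0
    · rw [hzero Ω h0]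
      exact zero_le
    obtain ⟨m, v, d, hm, hv, hd, hme, hve, hde, hball⟩ := hpos Ω hΩ h0
    have hk' : (0 : ℝ) < k := by exact_mod_cast hk
    have hke : (k : ℝ≥0∞) = ENNReal.ofReal k := (ENNReal.ofReal_natCast k).symm
    have heig := (hmain Ω hΩ k hk _ (by positivity) (hball k hk)).2 hpn.le
    refine (mul_le_mul_right heig _).trans (le_of_eq ?_)
    rw [hme, hke, hce, hQe, hwe, hde, ← ENNReal.ofReal_mul hc'.le,
      ← ENNReal.ofReal_div_of_pos (by positivity), ENNReal.ofReal_rpow_of_pos hm,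
      ENNReal.ofReal_rpow_of_pos hQ', ENNReal.ofReal_rpow_of_pos hd,
      ENNReal.ofReal_rpow_of_pos hk', ← ENNReal.ofReal_mul (by positivity),
      ← ENNReal.ofReal_mul (by positivity), ← ENNReal.ofReal_mul (by positivity),
      ← ENNReal.ofReal_mul (by positivity), ← ENNReal.ofReal_div_of_pos (by positivity),
      ← ENNReal.ofReal_mul (by positivity), ← ENNReal.ofReal_mul (by positivity),
      ← ENNReal.ofReal_mul (by positivity)]
    congr 1
    have e1 : (p - 1) / ((n : ℝ) - 1) = 1 + (p - n) / (n - 1) := by field_simp; ring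
    have e2 : (1 : ℝ) / (n - 1) * (n - p) = -((p - n) / (n - 1)) := by field_simp; ring
    have e3 : ((m / (c * k) / (2 * d * w')) ^ ((1 : ℝ) / (n - 1))) ^ ((n : ℝ) - p) =
        (2 * c * w') ^ ((p - n) / ((n : ℝ) - 1)) * d ^ ((p - n) / ((n : ℝ) - 1)) *
          k ^ ((p - n) / ((n : ℝ) - 1)) / m ^ ((p - n) / ((n : ℝ) - 1)) := by
      rw [← Real.rpow_mul (by positivity), e2, Real.rpow_neg (by positivity),
        ← Real.inv_rpow (by positivity), ← Real.mul_rpow (by positivity) hd.le,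
        ← Real.mul_rpow (by positivity) hk'.le, ← Real.div_rpow (by positivity) hm.le]
      congr 1
      field_simp
    have hm0 : m ^ ((p - n) / ((n : ℝ) - 1)) ≠ 0 := (Real.rpow_pos_of_pos hm _).ne'
    rw [e3, e1, Real.rpow_add hm, Real.rpow_one, Real.rpow_add hk', Real.rpow_one]
    generalize (Q : ℝ) ^ (p - 1) = q₁
    generalize L ^ p = q₂
    generalize (2 * c * w') ^ ((p - n) / ((n : ℝ) - 1)) = q₃
    generalize m ^ ((p - n) / ((n : ℝ) - 1)) = m₁ at *
    field_simp
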